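/- **Setting.** Let $\mathbb{F}_q$ be a finite field, $m\ge 3$ with $\gcd(m,q)=1$, and $r$ an integer with $r^3\equiv 1$ and $r\equiv q^{\epsilon}\pmod m$ for some $\epsilon\ge 1$. Let $G=\langle x,y\mid x^m=1,\ y^3=1,\ yx=x^ry\rangle$. A left $G_{(m,3,r)}$-code is a left ideal $\mathcal C$ of $\mathbb{F}_q[G]$; with $[\xi,\eta]_E=\sum_{i,j}a_{i,j}b_{i,j}$ for $\xi=\sum a_{i,j}x^iy^j$, $\eta=\sum b_{i,j}x^iy^j$ ($0\le i<m$, $0\le j\le 2$), its Euclidean dual is $\mathcal C^{\perp_E}=\{\xi : [\xi,\eta]_E=0\ \forall \eta\in\mathcal C\}$. Let $\zeta$ be a primitive $m$th root of unity in an extension of $\mathbb{F}_q$. Let $J(0),\dots,J(s+t)$ be the distinct $q$-cyclotomic cosets modulo $m$, numbered so that $rj\equiv j\pmod m$ for all $j\in J(i)$ if and only if $i\le s$. Put $d_i=|J(i)|$, $f_i(x)=\prod_{j\in J(i)}(x-\zeta^j)\in\mathbb{F}_q[x]$, $K_i=\mathbb{F}_q[x]/\langle f_i\rangle$, $F_i=(x^m-1)/f_i$,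 and $\varepsilon_i=u_iF_i$, where $u_iF_i+v_if_i=1$. Let $\theta_i\colon K_i\to K_i$, $a(x)\mapsto a(x^r)$ (so $\theta_i^3=\mathrm{id}$), and $\mathcal R_i=K_i[y;\theta_i]/\langle y^3-1\rangle$, where $ya=\theta_i(a)y$. For a left ideal $C_i$ of $\mathcal R_i$ put $\mathcal A_i\Box C_i=\{\varepsilon_i(x)\xi \bmod (x^m-1) : \xi\in C_i\}\subseteq\mathbb{F}_q[G]$. Define $\mu(i)$ by $J(\mu(i))=-J(i)$, and let $\mu\colon K_i\to K_{\mu(i)}$, $a(x)\mapsto a(x^{-1})$. Let $\zeta_i$ be a primitive element of $K_i$. If $q^{d_i}\equiv1\pmod 3$, put $\omega_i(x)=\zeta_i^{(q^{d_i}-1)/3}$. For $i>s$ let $\mathcal G_i$ be the subgroup of $K_i^\times$ generated by $\zeta_i^{\,q^{d_i/3}-1}$, and for $\alpha\in\mathcal G_i$ put $$C_{i,2,\alpha}=\mathcal R_i(-\alpha+y),\quad C_{i,1,\alpha}=\mathcal R_i(\alpha^{-1}+\theta_i^2(\alpha)y+y^2),\quad \widehat\alpha=\mu(\alpha)^{q^{2d_i/3}+q^{d_i/3}}\in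 K_{\mu(i)}.$$ **Theorem 4.5.** Let $\mathcal C=\bigoplus_{i=0}^{s+t}\mathcal A_i\Box C_i$ be a left $G_{(m,3,r)}$-code over $\mathbb{F}_q$, where each $C_i$ is a left ideal of $\mathcal R_i$. Then $\mathcal C^{\perp_E}$ is also a left $G_{(m,3,r)}$-code, and $\mathcal C^{\perp_E}=\bigoplus_{i=0}^{s+t}\mathcal A_i\Box D_i$ with left ideals $D_i$ of $\mathcal R_i$ given as follows; for each $i$, one of the listed forms of $C_i$ occurs. (i) Let $0\le i\le s$. Then $\theta_i=\mathrm{id}$, so that $\mathcal R_i=K_i[y]/\langle y^3-1\rangle$. (i-1) If $q\equiv0\pmod3$ and $C_i=\mathcal R_ig(y)$ with $g\in\{1,y-1,(y-1)^2,(y-1)^3\}$, then $D_{\mu(i)}=\mathcal R_{\mu(i)}\frac{(y-1)^3}{g(y)}$. (i-2) If $q^{d_i}\equiv2\pmod3$ and $C_i=\mathcal R_ig(y)$ with $g\in\{1,y-1,y^2+y+1,y^3-1\}$, then $D_{\mu(i)}=\mathcal R_{\mu(i)}\frac{y^3-1}{g(y)}$. (i-3) If $q^{d_i}\equiv1\pmod3$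 and $C_i=\mathcal R_ig(y)$, then $D_{\mu(i)}=\mathcal R_{\mu(i)}\vartheta(y)$, where, with $\omega=\omega_i(x)\in K_i$ and $\omega'=\omega_i(x^{-1})=\mu(\omega_i)\in K_{\mu(i)}$, the pair $(g,\vartheta)$ is one of $(1,\ y^3-1)$; $(y-1,\ y^2+y+1)$; $(y-\omega,\ (y-1)(y-\omega'))$; $(y-\omega^2,\ (y-1)(y-\omega'^2))$; $(y^2+y+1,\ y-1)$; $((y-1)(y-\omega^2),\ y-\omega'^2)$; $((y-1)(y-\omega),\ y-\omega')$; $(y^3-1,\ 1)$. (ii) Let $s+1\le i\le s+t$, and write $\theta=\theta_{\mu(i)}$. (ii-1) If $C_i=C_{i,1,\alpha}$ with $\alpha\in\mathcal G_i$, then $\theta(\widehat\alpha)\in\mathcal G_{\mu(i)}$, $D_{\mu(i)}=C_{\mu(i),2,\theta(\widehat\alpha)}$, and a generator matrix of $D_{\mu(i)}$, as a linear code of length $3$ over $K_{\mu(i)}$, is $\begin{pmatrix}-\theta(\widehat\alpha)&1&0\\0&-\theta(\theta(\widehat\alpha))&1\end{pmatrix}$. (ii-2) If $C_i=C_{i,2,\alpha}$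 with $\alpha\in\mathcal G_i$, then $\theta^2(\widehat\alpha)\in\mathcal G_{\mu(i)}$, $D_{\mu(i)}=\mathcal R_{\mu(i)}\big(\theta^2(\widehat\alpha^{-1})+\theta(\widehat\alpha)y+y^2\big)=C_{\mu(i),1,\theta^2(\widehat\alpha)}$, and a generator matrix of $D_{\mu(i)}$ is $\big((\theta^2(\widehat\alpha))^{-1},\ \theta^2(\theta^2(\widehat\alpha)),\ 1\big)$. (ii-3) $D_{\mu(i)}=\{0\}$ if $C_i=\mathcal R_i$, and $D_{\mu(i)}=\mathcal R_{\mu(i)}$ if $C_i=\{0\}$. -/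

import Mathlib

open Polynomial

noncomputable section

/-! ### The ring `K[y;θ]/⟨y³ - 1⟩` -/

/-- Ring endomorphisms `θ` of `K` with `θ³ = id`. -/
abbrev CubicEndo (K : Type*) [CommRing K] : Type _ :=
  {σ : K →+* K // ∀ a, σ (σ (σ a)) = a}

/-- The residue class ring `K[y;θ]/⟨y³ - 1⟩` of the skew polynomial ring `K[y;θ]`
(where `y a = θ(a) y`), on the reduced representatives `c₀ + c₁ y + c₂ y²`. -/
@[ext]
structure SkewCyclic (K : Type*) [CommRing K] (θ : CubicEndo K) where
  coeff : Fin 3 → K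

namespace SkewCyclic

variable {K : Type*} [CommRing K] {θ : CubicEndo K}

instance : Zero (SkewCyclic K θ) := ⟨⟨0⟩⟩
instance : One (SkewCyclic K θ) := ⟨⟨![1, 0, 0]⟩⟩
instance : Add (SkewCyclic K θ) := ⟨fun a b => ⟨a.coeff + b.coeff⟩⟩
instance : Neg (SkewCyclic K θ) := ⟨fun a => ⟨-a.coeff⟩⟩

/-- `(a yⁱ)(b yʲ) = a θⁱ(b) yⁱ⁺ʲ`, exponents of `y` being taken modulo `3`. -/
instance : Mul (SkewCyclic K θ) :=
  ⟨fun a b => ⟨fun k => ∑ i : Fin 3, a.coeff i * (θ.1)^[(i : ℕ)] (b.coeff (k - i))⟩⟩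

theorem coeff_zero : (0 : SkewCyclic K θ).coeff = 0 := rfl
theorem coeff_one : (1 : SkewCyclic K θ).coeff = ![1, 0, 0] := rfl
theorem coeff_add (a b : SkewCyclic K θ) : (a + b).coeff = a.coeff + b.coeff := rfl
theorem coeff_neg (a : SkewCyclic K θ) : (-a).coeff = -a.coeff := rfl
theorem coeff_mul (a b : SkewCyclic K θ) (k : Fin 3) : (a * b).coeff k =
    ∑ i : Fin 3, a.coeff i * (θ.1)^[(i : ℕ)] (b.coeff (k - i)) := rfl

theorem coeff_mul_zero (a b : SkewCyclic K θ) : (a * b).coeff 0 =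
    a.coeff 0 * b.coeff 0 + a.coeff 1 * θ.1 (b.coeff 2)
      + a.coeff 2 * θ.1 (θ.1 (b.coeff 1)) := by
  rw [coeff_mul, Fin.sum_univ_three]; rfl

theorem coeff_mul_one (a b : SkewCyclic K θ) : (a * b).coeff 1 =
    a.coeff 0 * b.coeff 1 + a.coeff 1 * θ.1 (b.coeff 0)
      + a.coeff 2 * θ.1 (θ.1 (b.coeff 2)) := by
  rw [coeff_mul, Fin.sum_univ_three]; rfl

theorem coeff_mul_two (a b : SkewCyclic K θ) : (a * b).coeff 2 =
    a.coeff 0 * b.coeff 2 + a.coeff 1 * θ.1 (b.coeff 1)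
      + a.coeff 2 * θ.1 (θ.1 (b.coeff 0)) := by
  rw [coeff_mul, Fin.sum_univ_three]; rfl

theorem ext3 {a b : SkewCyclic K θ} (h0 : a.coeff 0 = b.coeff 0) (h1 : a.coeff 1 = b.coeff 1)
    (h2 : a.coeff 2 = b.coeff 2) : a = b := by
  ext k; fin_cases k <;> assumption

instance : Ring (SkewCyclic K θ) where
  add_assoc a b c := by ext k; simp [coeff_add, add_assoc]
  zero_add a := by ext k; simp [coeff_add, coeff_zero]
  add_zero a := by ext k; simp [coeff_add, coeff_zero]
  add_comm a b := by ext k; simp [coeff_add, add_comm]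
  neg_add_cancel a := by ext k; simp [coeff_add, coeff_neg, coeff_zero]
  nsmul := nsmulRec
  zsmul := zsmulRec
  left_distrib a b c := by
    apply ext3 <;>
      simp only [coeff_mul_zero, coeff_mul_one, coeff_mul_two, coeff_add, Pi.add_apply, map_add] <;>
      ring
  right_distrib a b c := by
    apply ext3 <;>
      simp only [coeff_mul_zero, coeff_mul_one, coeff_mul_two, coeff_add, Pi.add_apply] <;>
      ring
  zero_mul a := by
    apply ext3 <;> simp [coeff_mul_zero, coeff_mul_one, coeff_mul_two, coeff_zero]
  mul_zero a := by
    apply ext3 <;> simp [coeff_mul_zero, coeff_mul_one, coeff_mul_two, coeff_zero]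
  one_mul a := by
    apply ext3 <;> simp [coeff_mul_zero, coeff_mul_one, coeff_mul_two, coeff_one]
  mul_one a := by
    apply ext3 <;> simp [coeff_mul_zero, coeff_mul_one, coeff_mul_two, coeff_one]
  mul_assoc a b c := by
    have h := θ.2
    apply ext3 <;>
      simp only [coeff_mul_zero, coeff_mul_one, coeff_mul_two, map_add, map_mul, h] <;> ring

/-- A constant `a ∈ K` as an element of `K[y;θ]/⟨y³ - 1⟩`. -/
def const (a : K) : SkewCyclic K θ := ⟨![a, 0, 0]⟩

/-- The class of `y`. -/
def y : SkewCyclic K θ := ⟨![0, 1, 0]⟩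

theorem y_mul_const (a : K) : (y : SkewCyclic K θ) * const a = const (θ.1 a) * y := by
  apply ext3 <;> simp [coeff_mul_zero, coeff_mul_one, coeff_mul_two, y, const]

theorem y_pow_three : (y : SkewCyclic K θ) ^ 3 = 1 := by
  rw [pow_succ, pow_two]
  apply ext3 <;> simp [coeff_mul_zero, coeff_mul_one, coeff_mul_two, y, coeff_one]

theorem eq_const_add (c : SkewCyclic K θ) :
    c = const (c.coeff 0) + const (c.coeff 1) * y + const (c.coeff 2) * y ^ 2 := by
  rw [pow_two]
  apply ext3 <;> simp only [coeff_add, Pi.add_apply, coeff_mul_zero, coeff_mul_one,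
    coeff_mul_two] <;> simp [y, const]

/-- `M` is a generator matrix of the left ideal `D`, seen as a linear code of length `3` over `K`
through `c₀ + c₁ y + c₂ y² ↦ (c₀, c₁, c₂)`: the rows of `M` form a basis of the code. -/
def IsGeneratorMatrix {k : ℕ} (M : Matrix (Fin k) (Fin 3) K) (D : Ideal (SkewCyclic K θ)) : Prop :=
  LinearIndependent K (fun i => M i) ∧
    ∀ v : SkewCyclic K θ, v ∈ D ↔ v.coeff ∈ Submodule.span K (Set.range fun i => M i)

end SkewCyclic

/-! ### The metacyclic group and its group algebra -/

/-- The relators `x ^ m`, `y ^ 3`, `y x (x ^ r y)⁻¹`, with `x`, `y` the generators `0`, `1`. -/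
def metacyclicRels (m r : ℕ) : Set (FreeGroup (Fin 2)) :=
  {FreeGroup.of 0 ^ m, FreeGroup.of 1 ^ 3,
    FreeGroup.of 1 * FreeGroup.of 0 * (FreeGroup.of 0 ^ r * FreeGroup.of 1)⁻¹}

/-- `G_(m,3,r) = ⟨x, y ∣ x ^ m = 1, y ^ 3 = 1, y x = x ^ r y⟩`. -/
abbrev MetacyclicGroup (m r : ℕ) : Type := PresentedGroup (metacyclicRels m r)

namespace MetacyclicGroup

def x (m r : ℕ) : MetacyclicGroup m r := PresentedGroup.of 0

def y (m r : ℕ) : MetacyclicGroup m r := PresentedGroup.of 1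

end MetacyclicGroup

/-- A left `G_(m,3,r)`-code over `F`: a subset of the group algebra that is a left ideal. -/
def IsLeftCode {F : Type*} [Field F] {m r : ℕ}
    (S : Set (MonoidAlgebra F (MetacyclicGroup m r))) : Prop :=
  ∃ I : Ideal (MonoidAlgebra F (MetacyclicGroup m r)), (I : Set _) = S

/-- The Euclidean inner product `∑ aᵢⱼ bᵢⱼ` of `∑ aᵢⱼ xⁱ yʲ` and `∑ bᵢⱼ xⁱ yʲ`. -/
def euclideanInner {F : Type*} [Field F] {m r : ℕ}
    (ξ η : MonoidAlgebra F (MetacyclicGroup m r)) : F :=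
  ∑ i ∈ Finset.range m, ∑ j ∈ Finset.range 3,
    ξ.coeff (MetacyclicGroup.x m r ^ i * MetacyclicGroup.y m r ^ j) *
      η.coeff (MetacyclicGroup.x m r ^ i * MetacyclicGroup.y m r ^ j)

/-- The Euclidean dual code. -/
def euclideanDual {F : Type*} [Field F] {m r : ℕ}
    (S : Set (MonoidAlgebra F (MetacyclicGroup m r))) :
    Set (MonoidAlgebra F (MetacyclicGroup m r)) :=
  {ξ | ∀ η ∈ S, euclideanInner ξ η = 0}

/-! ### Parameters -/

/-- The parameters: `m ≥ 3` coprime to `q = |F|`, `r³ ≡ 1` and `r ≡ q ^ ε` modulo `m`, `ε > 0`, and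
a primitive `m`-th root of unity `ζ` in an extension field `L` of `F`. -/
structure MetacyclicData (F L : Type*) [Field F] [Fintype F] [Field L] [Algebra F L] where
  m : ℕ
  r : ℕ
  ε : ℕ
  ζ : L
  three_le : 3 ≤ m
  coprime : Nat.Coprime m (Fintype.card F)
  r_cube : r ^ 3 ≡ 1 [MOD m]
  ε_pos : 0 < ε
  r_modEq : r ≡ Fintype.card F ^ ε [MOD m]
  isPrimitiveRoot : IsPrimitiveRoot ζ m

namespace MetacyclicData

variable {F L : Type*} [Field F] [Fintype F] [Field L] [Algebra F L] (P : MetacyclicData F L)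

instance : NeZero P.m := ⟨by have := P.three_le; omega⟩

/-- The order `q` of the ground field. -/
def q (_P : MetacyclicData F L) : ℕ := Fintype.card F

open Classical in
/-- The `q`-cyclotomic coset `{s, sq, sq², …}` modulo `m`. -/
def cyclotomicCoset (s : ZMod P.m) : Finset (ZMod P.m) :=
  Finset.univ.filter fun a => ∃ k : ℕ, a = s * (P.q : ZMod P.m) ^ k

/-- The set of all `q`-cyclotomic cosets modulo `m`. -/
def Coset : Type := {J : Finset (ZMod P.m) // ∃ s, J = P.cyclotomicCoset s}

variable {P}

theorem mem_cyclotomicCoset {s a : ZMod P.m} :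
    a ∈ P.cyclotomicCoset s ↔ ∃ k : ℕ, a = s * (P.q : ZMod P.m) ^ k := by
  simp [cyclotomicCoset]

/-- The coset `-J`, written `μ(i)` when `J = J(i)`. -/
def Coset.neg (J : P.Coset) : P.Coset :=
  ⟨J.1.image (fun a => -a), by
    obtain ⟨s, hs⟩ := J.2
    refine ⟨-s, ?_⟩
    ext a
    simp only [hs, Finset.mem_image, mem_cyclotomicCoset]
    constructor
    · rintro ⟨b, ⟨k, rfl⟩, rfl⟩
      exact ⟨k, by ring⟩
    · rintro ⟨k, rfl⟩
      exact ⟨_, ⟨k, rfl⟩, by ring⟩⟩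

/-- `θ(j) = r j = j` for all `j ∈ J`. These are the cosets `J(0), …, J(s)`; the others are
`J(s+1), …, J(s+t)`. -/
def Coset.IsFixed (J : P.Coset) : Prop := ∀ j ∈ J.1, (P.r : ZMod P.m) * j = j

/-- `dᵢ = |J(i)|`. -/
def Coset.d (J : P.Coset) : ℕ := J.1.card

theorem Coset.q_mul_mem (J : P.Coset) {j : ZMod P.m} (hj : j ∈ J.1) :
    (P.q : ZMod P.m) * j ∈ J.1 := by
  obtain ⟨s, hs⟩ := J.2
  rw [hs, mem_cyclotomicCoset] at hj ⊢
  obtain ⟨k, rfl⟩ := hj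
  exact ⟨k + 1, by ring⟩

theorem zeta_pow_val_natCast (n : ℕ) (j : ZMod P.m) :
    P.ζ ^ (((n : ZMod P.m) * j).val) = (P.ζ ^ j.val) ^ n := by
  rw [← pow_mul]
  refine pow_eq_pow_of_modEq ?_ P.isPrimitiveRoot.pow_eq_one
  rw [← ZMod.natCast_eq_natCast_iff]
  simp [mul_comm]

theorem mem_range_of_pow_card {c : L} (h : c ^ Fintype.card F = c) :
    c ∈ (algebraMap F L).range := by
  have h1 : (X ^ Fintype.card F - X : F[X]) = ∏ a : F, (X - C a) := by
    have h2 := prod_multiset_X_sub_C_of_monic_of_roots_card_eq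
      (p := (X ^ Fintype.card F - X : F[X]))
      (by
        refine (monic_X_pow _).sub_of_left ?_
        rw [degree_X_pow, degree_X]
        exact_mod_cast Fintype.one_lt_card)
      (by
        rw [FiniteField.roots_X_pow_card_sub_X,
          FiniteField.X_pow_card_sub_X_natDegree_eq _ Fintype.one_lt_card]
        rfl)
    rw [FiniteField.roots_X_pow_card_sub_X] at h2
    exact h2.symm
  have h3 := congrArg (aeval c) h1
  simp only [map_sub, map_pow, aeval_X, h, sub_self, map_prod, aeval_C] at h3
  obtain ⟨a, -, ha⟩ := Finset.prod_eq_zero_iff.1 h3.symm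
  exact ⟨a, (sub_eq_zero.1 ha).symm⟩

theorem exists_cosetPoly (J : P.Coset) :
    ∃ p : F[X], p.map (algebraMap F L) = ∏ j ∈ J.1, (X - C (P.ζ ^ j.val)) := by
  set p : L[X] := ∏ j ∈ J.1, (X - C (P.ζ ^ j.val)) with hp
  have hinj : Set.InjOn (fun j : ZMod P.m => (P.q : ZMod P.m) * j) J.1 := by
    have hu : IsUnit (P.q : ZMod P.m) := by
      rw [ZMod.isUnit_iff_coprime]; exact P.coprime.symm
    exact fun a _ b _ hab => hu.mul_left_cancel hab
  have himg : J.1.image (fun j : ZMod P.m => (P.q : ZMod P.m) * j) = J.1 := by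
    refine Finset.eq_of_subset_of_card_le ?_ ?_
    · intro a ha
      obtain ⟨b, hb, rfl⟩ := Finset.mem_image.1 ha
      exact J.q_mul_mem hb
    · rw [Finset.card_image_of_injOn hinj]
  have hfix : p.map (FiniteField.frobeniusAlgHom F L : L →+* L) = p := by
    rw [hp, Polynomial.map_prod]
    conv_rhs => rw [← himg, Finset.prod_image hinj]
    refine Finset.prod_congr rfl fun j _ => ?_
    rw [zeta_pow_val_natCast, Polynomial.map_sub, map_X, map_C]
    rfl
  have hl : p ∈ Polynomial.lifts (algebraMap F L) := by
    rw [Polynomial.lifts_iff_coeff_lifts]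
    intro n
    have h1 := congrArg (fun s => s.coeff n) hfix
    simp only [coeff_map] at h1
    exact mem_range_of_pow_card (F := F) h1
  exact (Polynomial.mem_lifts _).1 hl

/-- `fᵢ(x) = ∏_{j ∈ J(i)} (x - ζ ^ j)`, as a polynomial over `F`. -/
def Coset.f (J : P.Coset) : F[X] := Classical.choose (exists_cosetPoly J)

theorem Coset.map_f (J : P.Coset) :
    J.f.map (algebraMap F L) = ∏ j ∈ J.1, (X - C (P.ζ ^ j.val)) :=
  Classical.choose_spec (exists_cosetPoly J)

/-- `Fᵢ(x) = (x ^ m - 1) / fᵢ(x)`. -/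
def Coset.cof (J : P.Coset) : F[X] := (X ^ P.m - 1) / J.f

/-- A polynomial over `F` is a multiple of `fᵢ` if it vanishes at `ζ ^ j` for all `j ∈ J(i)`. -/
theorem Coset.f_dvd (J : P.Coset) {g : F[X]} (h : ∀ j ∈ J.1, aeval (P.ζ ^ j.val) g = 0) :
    J.f ∣ g := by
  rw [← Polynomial.map_dvd_map' (algebraMap F L), J.map_f]
  refine Finset.prod_dvd_of_coprime ?_ ?_
  · intro a _ b _ hab
    refine isCoprime_X_sub_C_of_isUnit_sub ?_
    refine IsUnit.mk0 _ (sub_ne_zero.2 fun h => hab ?_)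
    exact ZMod.val_injective _
      (P.isPrimitiveRoot.pow_inj (ZMod.val_lt a) (ZMod.val_lt b) h)
  · intro j hj
    rw [dvd_iff_isRoot, IsRoot.def, eval_map_algebraMap]
    exact h j hj

theorem Coset.aeval_f (J : P.Coset) {j : ZMod P.m} (hj : j ∈ J.1) :
    aeval (P.ζ ^ j.val) J.f = 0 := by
  rw [← eval_map_algebraMap, J.map_f, eval_prod]
  exact Finset.prod_eq_zero hj (by simp)

theorem Coset.f_dvd_X_pow_sub_one (J : P.Coset) : J.f ∣ (X ^ P.m - 1 : F[X]) := by
  refine J.f_dvd fun j _ => ?_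
  rw [map_sub, map_pow, aeval_X, map_one, pow_right_comm, P.isPrimitiveRoot.pow_eq_one, one_pow,
    sub_self]

theorem Coset.exists_bezout (J : P.Coset) : ∃ u v : F[X], u * J.cof + v * J.f = 1 := by
  have h0 : J.f ≠ 0 := by
    intro h
    have h1 := J.map_f
    rw [h, Polynomial.map_zero] at h1
    exact (Finset.prod_ne_zero_iff.2 fun j _ => X_sub_C_ne_zero _) h1.symm
  have hmul : J.cof * J.f = X ^ P.m - 1 := by
    rw [Coset.cof, mul_comm]
    exact EuclideanDomain.mul_div_cancel' h0 J.f_dvd_X_pow_sub_one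
  have hm : (P.m : F) ≠ 0 := by
    obtain ⟨p, hc, n, hp, hq⟩ := FiniteField.card' F
    have := P.coprime
    rw [hq] at this
    intro h
    rw [CharP.cast_eq_zero_iff F p] at h
    exact hp.one_lt.ne' (Nat.eq_one_of_dvd_coprimes this h (dvd_pow_self p n.ne_zero))
  have hs : (X ^ P.m - 1 : F[X]).Separable := X_pow_sub_one_separable_iff.2 hm
  rw [← hmul] at hs
  obtain ⟨u, v, huv⟩ := hs.isCoprime
  exact ⟨u, v, huv⟩

/-- `εᵢ(x) = uᵢ(x) Fᵢ(x)`, where `uᵢ Fᵢ + vᵢ fᵢ = 1`; modulo `x ^ m - 1` this does not depend on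
the choice of `uᵢ`, `vᵢ`. -/
def Coset.idem (J : P.Coset) : F[X] := Classical.choose J.exists_bezout * J.cof

/-! ### The fields `Kᵢ`, the maps `θᵢ` and `μ`, and the rings `Rᵢ` -/

/-- `Kᵢ = F[x]/⟨fᵢ(x)⟩`. -/
abbrev Coset.K (J : P.Coset) : Type _ := AdjoinRoot J.f

theorem Coset.aeval_root_pow (J J' : P.Coset) (n : ℕ)
    (h : ∀ j ∈ J'.1, (n : ZMod P.m) * j ∈ J.1) :
    J.f.eval₂ (Algebra.ofId F J'.K) (AdjoinRoot.root J'.f ^ n) = 0 := by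
  change aeval (AdjoinRoot.root J'.f ^ n) J.f = 0
  have h1 : aeval (AdjoinRoot.root J'.f ^ n) J.f = AdjoinRoot.mk J'.f (J.f.comp (X ^ n)) := by
    rw [← AdjoinRoot.aeval_eq, aeval_comp]
    simp
  rw [h1, AdjoinRoot.mk_eq_zero]
  refine J'.f_dvd fun j hj => ?_
  rw [aeval_comp, map_pow, aeval_X, ← zeta_pow_val_natCast]
  exact J.aeval_f (h j hj)

theorem Coset.root_pow_m (J : P.Coset) : AdjoinRoot.root J.f ^ P.m = 1 := by
  have h := AdjoinRoot.mk_eq_zero.2 J.f_dvd_X_pow_sub_one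
  simpa [sub_eq_zero] using h

theorem Coset.r_mul_mem (J : P.Coset) (j : ZMod P.m) (hj : j ∈ J.1) :
    (P.r : ZMod P.m) * j ∈ J.1 := by
  have h : (P.r : ZMod P.m) = (P.q : ZMod P.m) ^ P.ε := by
    have := (ZMod.natCast_eq_natCast_iff _ _ _).2 P.r_modEq
    simpa [q] using this
  rw [h]
  obtain ⟨s, hs⟩ := J.2
  rw [hs, mem_cyclotomicCoset] at hj ⊢
  obtain ⟨k, rfl⟩ := hj
  exact ⟨k + P.ε, by ring⟩

theorem Coset.pred_mul_mem_neg (J : P.Coset) (j : ZMod P.m) (hj : j ∈ J.neg.1) :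
    ((P.m - 1 : ℕ) : ZMod P.m) * j ∈ J.1 := by
  obtain ⟨a, ha, rfl⟩ := Finset.mem_image.1 hj
  have h1 : 1 ≤ P.m := by have := P.three_le; omega
  rw [Nat.cast_sub h1]
  simpa using ha

/-- `θᵢ : Kᵢ → Kᵢ`, `a(x) ↦ a(x ^ r)`. -/
def Coset.theta (J : P.Coset) : CubicEndo J.K :=
  ⟨(AdjoinRoot.liftAlgHom J.f (Algebra.ofId F J.K) (AdjoinRoot.root J.f ^ P.r)
      (J.aeval_root_pow J P.r J.r_mul_mem) : J.K →ₐ[F] J.K), by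
    set σ : J.K →ₐ[F] J.K := AdjoinRoot.liftAlgHom J.f (Algebra.ofId F J.K)
      (AdjoinRoot.root J.f ^ P.r) (J.aeval_root_pow J P.r J.r_mul_mem) with hσ
    have h : (σ.comp (σ.comp σ)) = AlgHom.id F J.K := by
      apply AdjoinRoot.algHom_ext
      have h1 : σ (AdjoinRoot.root J.f) = AdjoinRoot.root J.f ^ P.r := by
        rw [hσ, AdjoinRoot.liftAlgHom_root]
      simp only [AlgHom.comp_apply, h1, map_pow, AlgHom.id_apply]
      rw [← pow_mul, ← pow_mul, ← pow_three]
      conv_rhs => rw [← pow_one (AdjoinRoot.root J.f)]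
      exact pow_eq_pow_of_modEq P.r_cube J.root_pow_m
    intro a
    exact DFunLike.congr_fun h a⟩

/-- `μ : Kᵢ → K_{μ(i)}`, `a(x) ↦ a(x⁻¹) = a(x ^ (m-1))`. -/
def Coset.mu (J : P.Coset) : J.K →+* J.neg.K :=
  (AdjoinRoot.liftAlgHom J.f (Algebra.ofId F J.neg.K) (AdjoinRoot.root J.neg.f ^ (P.m - 1))
    (J.aeval_root_pow J.neg (P.m - 1) J.pred_mul_mem_neg) : J.K →ₐ[F] J.neg.K)

/-- `θᵢ` on the units of `Kᵢ`. -/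
def Coset.thetaU (J : P.Coset) : J.Kˣ →* J.Kˣ := Units.map J.theta.1.toMonoidHom

/-- `α̂ = α(x ^ (m-1)) ^ (q^(2dᵢ/3) + q^(dᵢ/3))` in `K_{μ(i)}`. -/
def Coset.hat (J : P.Coset) (α : J.Kˣ) : J.neg.Kˣ :=
  Units.map J.mu.toMonoidHom α ^ (P.q ^ (2 * J.d / 3) + P.q ^ (J.d / 3))

/-- `𝒢ᵢ`, the subgroup generated by `ϱᵢ = z ^ (q^(dᵢ/3) - 1)`, for a primitive element `z` of
`Kᵢ`. -/
def Coset.calG (J : P.Coset) (z : J.Kˣ) : Subgroup J.Kˣ :=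
  Subgroup.zpowers (z ^ (P.q ^ (J.d / 3) - 1))

/-- `ωᵢ = z ^ ((q^dᵢ - 1) / 3)`, for a primitive element `z` of `Kᵢ`. -/
def Coset.omega (J : P.Coset) (z : J.Kˣ) : J.K := (z : J.K) ^ ((P.q ^ J.d - 1) / 3)

/-- `Rᵢ = Kᵢ[y;θᵢ]/⟨y³ - 1⟩`. -/
abbrev Coset.R (J : P.Coset) : Type _ := SkewCyclic J.K J.theta

open SkewCyclic (const y)

/-- `C_{i,2,α} = Rᵢ (-α + y)`. -/
def Coset.codeTwo (J : P.Coset) (α : J.Kˣ) : Ideal J.R :=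
  Ideal.span {-const (α : J.K) + y}

/-- `C_{i,1,α} = Rᵢ (α⁻¹ + θᵢ²(α) y + y²)`. -/
def Coset.codeOne (J : P.Coset) (α : J.Kˣ) : Ideal J.R :=
  Ideal.span {const ((α⁻¹ : J.Kˣ) : J.K) + const (J.thetaU (J.thetaU α) : J.K) * y + y ^ 2}

/-! ### Concatenation -/

variable (P) in
/-- The group algebra `F[G_(m,3,r)]`. -/
abbrev GroupAlg : Type _ := MonoidAlgebra F (MetacyclicGroup P.m P.r)

variable (P) in
/-- `a(x)` in the group algebra, for `a ∈ F[x]`. -/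
def evalX : F[X] →ₐ[F] P.GroupAlg :=
  aeval (MonoidAlgebra.of F _ (MetacyclicGroup.x P.m P.r))

variable (P) in
/-- `y` in the group algebra. -/
def algY : P.GroupAlg := MonoidAlgebra.of F _ (MetacyclicGroup.y P.m P.r)

/-- The concatenated code `𝒜ᵢ □ C = {εᵢ(x) ξ mod (x ^ m - 1) ∣ ξ ∈ C}`. Here
`ξ = a₀(x) + a₁(x) y + a₂(x) y²` with the `aⱼ ∈ F[x]` taken modulo `fᵢ`; the element `εᵢ(x) ξ` does
not depend on the representatives `aⱼ`, as `εᵢ fᵢ` is a multiple of `x ^ m - 1`. -/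
def Coset.concat (J : P.Coset) (I : Ideal J.R) : Submodule F P.GroupAlg where
  carrier := {v | ∃ a : Fin 3 → F[X], (⟨fun j => AdjoinRoot.mk J.f (a j)⟩ : J.R) ∈ I ∧
    v = ∑ j : Fin 3, P.evalX (J.idem * a j) * P.algY ^ (j : ℕ)}
  zero_mem' := ⟨0, by
    have : (⟨fun j => AdjoinRoot.mk J.f ((0 : Fin 3 → F[X]) j)⟩ : J.R) = 0 := by
      ext j; simp [SkewCyclic.coeff_zero]
    rw [this]; exact I.zero_mem, by simp⟩
  add_mem' := by
    rintro _ _ ⟨a, ha, rfl⟩ ⟨b, hb, rfl⟩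
    refine ⟨a + b, ?_, ?_⟩
    · have h : (⟨fun j => AdjoinRoot.mk J.f ((a + b) j)⟩ : J.R) =
          ⟨fun j => AdjoinRoot.mk J.f (a j)⟩ + ⟨fun j => AdjoinRoot.mk J.f (b j)⟩ := by
        ext j; simp [SkewCyclic.coeff_add]
      rw [h]; exact I.add_mem ha hb
    · simp [mul_add, add_mul, Finset.sum_add_distrib]
  smul_mem' := by
    rintro c _ ⟨a, ha, rfl⟩
    refine ⟨fun j => C c * a j, ?_, ?_⟩
    · have h : (⟨fun j => AdjoinRoot.mk J.f (C c * a j)⟩ : J.R) =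
          const (AdjoinRoot.mk J.f (C c)) * ⟨fun j => AdjoinRoot.mk J.f (a j)⟩ := by
        apply SkewCyclic.ext3 <;>
          simp [SkewCyclic.coeff_mul_zero, SkewCyclic.coeff_mul_one, SkewCyclic.coeff_mul_two,
            const]
      rw [h]; exact I.mul_mem_left _ ha
    · rw [Finset.smul_sum]
      refine Finset.sum_congr rfl fun j _ => ?_
      rw [mul_left_comm, ← smul_eq_C_mul, map_smul, smul_mul_assoc]

/-- `S = ⨁ᵢ 𝒜ᵢ □ Cᵢ`, an internal direct sum. -/
def IsConcatSum (S : Set P.GroupAlg) (C : ∀ J : P.Coset, Ideal J.R) : Prop :=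
  iSupIndep (fun J : P.Coset => J.concat (C J)) ∧
    ((⨆ J : P.Coset, J.concat (C J) : Submodule F P.GroupAlg) : Set P.GroupAlg) = S

/-! ### The tables of pairs `(g, h)`, where `Cᵢ = Rᵢ g` and `D_{μ(i)} = R_{μ(i)} h` -/

/-- `g ∈ {1, y - 1, (y - 1)², (y - 1)³}` and `h = (y - 1)³ / g`. -/
def Coset.tableZero (J : P.Coset) : Set (J.R × J.neg.R) :=
  {(1, (y - 1) ^ 3), (y - 1, (y - 1) ^ 2), ((y - 1) ^ 2, y - 1), ((y - 1) ^ 3, 1)}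

/-- `g ∈ {1, y - 1, y² + y + 1, y³ - 1}` and `h = (y³ - 1) / g`. -/
def Coset.tableTwo (J : P.Coset) : Set (J.R × J.neg.R) :=
  {(1, y ^ 3 - 1), (y - 1, y ^ 2 + y + 1), (y ^ 2 + y + 1, y - 1), (y ^ 3 - 1, 1)}

/-- The table for `q ^ dᵢ ≡ 1` modulo `3`, with `w = ωᵢ(x)` and `w' = ωᵢ(x⁻¹)`. -/
def Coset.tableOne (J : P.Coset) (w : J.K) (w' : J.neg.K) : Set (J.R × J.neg.R) :=
  {(1, y ^ 3 - 1),
    (y - 1, y ^ 2 + y + 1),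
    (y - const w, (y - 1) * (y - const w')),
    (y - const (w ^ 2), (y - 1) * (y - const (w' ^ 2))),
    (y ^ 2 + y + 1, y - 1),
    ((y - 1) * (y - const (w ^ 2)), y - const (w' ^ 2)),
    ((y - 1) * (y - const w), y - const w'),
    (y ^ 3 - 1, 1)}

/-- `C` is `Rᵢ g` for some pair `(g, h)` of the table `T`, and `D = R_{μ(i)} h` for every pair
`(g, h)` of `T` with `C = Rᵢ g`. -/
def Coset.FollowsTable (J : P.Coset) (T : Set (J.R × J.neg.R)) (C : Ideal J.R)
    (D : Ideal J.neg.R) : Prop :=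
  (∃ p ∈ T, C = Ideal.span {p.1}) ∧ ∀ p ∈ T, C = Ideal.span {p.1} → D = Ideal.span {p.2}

end MetacyclicData

end

/-! The duality becomes a computation of one-sided annihilators. Let `*` be the linear extension of
`g ↦ g⁻¹` to the group algebra. Since every group element is `xⁱyʲ` for exactly one pair `i < m`, `j
< 3`, the Euclidean product of `ξ` and `η` is the coefficient of `1` in `ξ η*`. If `η` runs over a
left ideal, so does `gη`, and these translates pick out every coefficient of `ξ η*`. Hence the dual
of a left ideal `I` is the left annihilator of `I*` (`mem_euclideanDual_iff`), which is again a left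
ideal.

As `x^m - 1` is the product of the `fᵢ`, which are irreducible and pairwise coprime, the maps
`Coset.toR` identify the group algebra with the product of the rings `Rᵢ`, and `⨁ 𝒜ᵢ □ Cᵢ` with the
elements whose `i`-th component lies in `Cᵢ` (`isConcatSum_iff`). Under this identification `*`
turns into the anti-multiplicative map `star : Rᵢ → R_{μ(i)}`, `∑ aⱼyʲ ↦ ∑ y⁻ʲμ(aⱼ)`
(`Coset.toR_neg_invol`). So `D_{μ(i)}` is the left annihilator of `star Cᵢ` (`exists_dual`), and one
ring at a time remains.

If `J(i)` is fixed, `Rᵢ = Kᵢ[y]/⟨y³ - 1⟩` is commutative, its ideals come from the divisors of `y³ -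
1`, `star g` is a unit times the reciprocal polynomial `h` of `g`, and the annihilator of `h` is
generated by `(y³ - 1)/h`. This gives the tables.

Otherwise a proper nonzero left ideal is generated by `y - α` or by `α⁻¹ + θ²(α)y + y²` with
`αθ(α)θ²(α) = 1` (`ideal_classification`). The group `𝒢ᵢ` consists exactly of these norm-one
elements (`Coset.mem_calG_iff`), and on them `α̂` is simply `μ(α)⁻¹` (`Coset.hat_eq_inv`); the
annihilators are then computed by comparing coefficients. -/

namespace SkewCyclic

/-! ### Left ideals of `K[y;θ]/⟨y³ - 1⟩` and their generator matrices. -/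

variable {K : Type*} [CommRing K] {θ : CubicEndo K}

@[simp] theorem coeff_const_zero (a : K) : (const a : SkewCyclic K θ).coeff 0 = a := rfl
@[simp] theorem coeff_const_one (a : K) : (const a : SkewCyclic K θ).coeff 1 = 0 := rfl
@[simp] theorem coeff_const_two (a : K) : (const a : SkewCyclic K θ).coeff 2 = 0 := rfl
@[simp] theorem coeff_y_zero : (y : SkewCyclic K θ).coeff 0 = 0 := rfl
@[simp] theorem coeff_y_one : (y : SkewCyclic K θ).coeff 1 = 1 := rfl
@[simp] theorem coeff_y_two : (y : SkewCyclic K θ).coeff 2 = 0 := rfl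
@[simp] theorem coeff_zero_apply (i : Fin 3) : (0 : SkewCyclic K θ).coeff i = 0 := rfl
@[simp] theorem coeff_one_zero : (1 : SkewCyclic K θ).coeff 0 = 1 := rfl
@[simp] theorem coeff_one_one : (1 : SkewCyclic K θ).coeff 1 = 0 := rfl
@[simp] theorem coeff_one_two : (1 : SkewCyclic K θ).coeff 2 = 0 := rfl
@[simp] theorem coeff_add_apply (a b : SkewCyclic K θ) (i : Fin 3) :
    (a + b).coeff i = a.coeff i + b.coeff i := rfl
@[simp] theorem coeff_neg_apply (a : SkewCyclic K θ) (i : Fin 3) :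
    (-a).coeff i = -a.coeff i := rfl
@[simp] theorem coeff_sub_apply (a b : SkewCyclic K θ) (i : Fin 3) :
    (a - b).coeff i = a.coeff i - b.coeff i := by
  rw [sub_eq_add_neg, coeff_add_apply, coeff_neg_apply, sub_eq_add_neg]

attribute [simp] coeff_mul_zero coeff_mul_one coeff_mul_two

theorem theta_theta_theta (a : K) : θ.1 (θ.1 (θ.1 a)) = a := θ.2 a

/-- The constants as a subring. -/
def constHom (θ : CubicEndo K) : K →+* SkewCyclic K θ where
  toFun := const
  map_one' := by apply ext3 <;> simp
  map_zero' := by apply ext3 <;> simp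
  map_mul' a b := by apply ext3 <;> simp
  map_add' a b := by apply ext3 <;> simp

@[simp] theorem constHom_apply (a : K) : constHom θ a = const a := rfl

theorem const_mul_const (a b : K) : (const a : SkewCyclic K θ) * const b = const (a * b) :=
  ((constHom θ).map_mul a b).symm

theorem const_one : (const 1 : SkewCyclic K θ) = 1 := (constHom θ).map_one

theorem eq_top_of_const_mem (hK : IsField K) {I : Ideal (SkewCyclic K θ)} {a : K} (ha : a ≠ 0)
    (h : const a ∈ I) : I = ⊤ := by
  obtain ⟨b, hb⟩ := hK.mul_inv_cancel ha
  rw [Ideal.eq_top_iff_one, ← const_one, ← hb, mul_comm, ← const_mul_const]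
  exact I.mul_mem_left _ h

/-- Right division by `y - α`. -/
theorem eq_const_add_mul (α : K) (e : SkewCyclic K θ) :
    e = const (e.coeff 0 + α * e.coeff 1 + α * θ.1 α * e.coeff 2) +
      (const (e.coeff 1 + e.coeff 2 * θ.1 α) + const (e.coeff 2) * y) * (-const α + y) := by
  apply ext3 <;> simp
  ring

/-- The right side is the remainder of `e` on right division by `y - α`. The norm condition says
that `y³ - 1` itself has remainder zero, so the remainder is well defined on the quotient ring. -/
theorem mem_span_y_sub_iff {α : K} (hα : α * θ.1 α * θ.1 (θ.1 α) = 1) (e : SkewCyclic K θ) :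
    e ∈ Ideal.span {(-const α + y : SkewCyclic K θ)} ↔
      e.coeff 0 + α * e.coeff 1 + α * θ.1 α * e.coeff 2 = 0 := by
  constructor
  · intro h
    obtain ⟨c, rfl⟩ := Ideal.mem_span_singleton'.1 h
    simp
    linear_combination (-c.coeff 2) * hα
  · intro h
    rw [eq_const_add_mul α e, h]
    refine add_mem ?_ (Ideal.mul_mem_left _ _ (Ideal.mem_span_singleton_self _))
    have h0 : (const 0 : SkewCyclic K θ) = 0 := (constHom θ).map_zero
    rw [h0]
    exact Submodule.zero_mem _

/-- Norm one gives `α⁻¹ = θ(α)θ²(α)`, whence `y` times the generator is `α` times the generator. The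
left ideal is therefore just the `K`-line through it. -/
theorem mem_span_quadratic_iff {α : Kˣ} (hα : (α : K) * θ.1 α * θ.1 (θ.1 α) = 1)
    (e : SkewCyclic K θ) :
    e ∈ Ideal.span {(const ((α⁻¹ : Kˣ) : K) + const (θ.1 (θ.1 α)) * y + y ^ 2 : SkewCyclic K θ)} ↔
      e.coeff 0 = e.coeff 2 * ((α⁻¹ : Kˣ) : K) ∧ e.coeff 1 = e.coeff 2 * θ.1 (θ.1 α) := by
  have h1 : ((α⁻¹ : Kˣ) : K) = θ.1 α * θ.1 (θ.1 α) :=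
    Units.inv_eq_of_mul_eq_one_right (by rw [← mul_assoc]; exact hα)
  rw [h1, pow_two]
  constructor
  · intro h
    obtain ⟨c, rfl⟩ := Ideal.mem_span_singleton'.1 h
    simp only [coeff_mul_zero, coeff_mul_one, coeff_mul_two, coeff_add_apply, coeff_const_zero,
      coeff_const_one, coeff_const_two, coeff_y_zero, coeff_y_one, coeff_y_two, map_mul, map_zero,
      map_one, theta_theta_theta, mul_zero, add_zero, zero_add, mul_one]
    constructor
    · linear_combination (-c.coeff 1 - c.coeff 2 * θ.1 α) * hα
    · linear_combination (-c.coeff 2) * hα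
  · rintro ⟨h0, h3⟩
    refine Ideal.mem_span_singleton'.2 ⟨const (e.coeff 2), ?_⟩
    apply ext3 <;> simp [h0, h3]

/-- The left ideals of `K[y;θ]/⟨y³ - 1⟩` for a field `K`, up to those containing a nonzero
polynomial of degree at most `1`. -/
theorem ideal_eq_top_or_of_mem (hK : IsField K) {I : Ideal (SkewCyclic K θ)} {e : SkewCyclic K θ}
    (he : e ∈ I) (he0 : e ≠ 0) (he2 : e.coeff 2 = 0) :
    I = ⊤ ∨ ∃ α : Kˣ, (α : K) * θ.1 α * θ.1 (θ.1 α) = 1 ∧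
      I = Ideal.span {-const (α : K) + y} := by
  by_cases h1 : e.coeff 1 = 0
  · left
    have h : e = const (e.coeff 0) := by apply ext3 <;> simp [h1, he2]
    refine eq_top_of_const_mem hK (a := e.coeff 0) (fun h0 => he0 ?_) (h ▸ he)
    apply ext3 <;> simp [h0, h1, he2]
  obtain ⟨b, hb⟩ := hK.mul_inv_cancel h1
  -- Scaling to leading coefficient `1` puts some `y - a` in `I`.
  have hu : -const (-(b * e.coeff 0)) + y ∈ I := by
    convert I.mul_mem_left (const b) he using 1
    apply ext3 <;> simp [he2, mul_comm b _, hb]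
  generalize -(b * e.coeff 0) = a at hu
  have hle : Ideal.span {-const a + y} ≤ I := (Ideal.span_singleton_le_iff_mem I).2 hu
  -- The remainder modulo `y - a` of any element of `I` is a constant of `I`, so `I = ⊤` as soon as
  -- one remainder is nonzero.
  have hconst : ∀ c ∈ I, const (c.coeff 0 + a * c.coeff 1 + a * θ.1 a * c.coeff 2) ∈ I := by
    intro c hc
    rw [eq_const_add_mul a c] at hc
    exact (I.add_mem_iff_left (I.mul_mem_left _ hu)).1 hc
  by_cases hN : a * θ.1 a * θ.1 (θ.1 a) = 1
  · by_cases hI : I ≤ Ideal.span {-const a + y}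
    · right
      refine ⟨Units.mkOfMulEqOne a (θ.1 a * θ.1 (θ.1 a)) (by rw [← mul_assoc]; exact hN), hN, ?_⟩
      exact le_antisymm hI hle
    · left
      obtain ⟨c, hc, hc'⟩ := Set.not_subset.1 hI
      exact eq_top_of_const_mem hK (fun h => hc' ((mem_span_y_sub_iff hN c).2 h)) (hconst c hc)
  · left
    -- `y²(y - a) = 1 - θ²(a)y²` has remainder `1 - aθ(a)θ²(a)`, nonzero when the norm of `a` is not
    -- `1`.
    have h := hconst _ (I.mul_mem_left (y * y) hu)
    refine eq_top_of_const_mem hK (fun h0 => hN ?_) h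
    simp at h0
    linear_combination -h0

/-- The left ideals of `K[y;θ]/⟨y³ - 1⟩` for a field `K`. -/
theorem ideal_classification (hK : IsField K) (I : Ideal (SkewCyclic K θ)) :
    (∃ α : Kˣ, (α : K) * θ.1 α * θ.1 (θ.1 α) = 1 ∧
      I = Ideal.span {const ((α⁻¹ : Kˣ) : K) + const (θ.1 (θ.1 α)) * y + y ^ 2}) ∨
    (∃ α : Kˣ, (α : K) * θ.1 α * θ.1 (θ.1 α) = 1 ∧ I = Ideal.span {-const (α : K) + y}) ∨
    I = ⊤ ∨ I = ⊥ := by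
  by_cases hA : ∃ e ∈ I, e ≠ 0 ∧ e.coeff 2 = 0
  · obtain ⟨e, he, he0, he2⟩ := hA
    rcases ideal_eq_top_or_of_mem hK he he0 he2 with h | h
    · exact Or.inr (Or.inr (Or.inl h))
    · exact Or.inr (Or.inl h)
  -- From here on, an element of `I` is determined by its `y²`-coefficient, so `I` is at most a
  -- line.
  replace hA : ∀ e ∈ I, e.coeff 2 = 0 → e = 0 := fun e he h2 =>
    by_contra fun h => hA ⟨e, he, h, h2⟩
  by_cases hI : I = ⊥
  · exact Or.inr (Or.inr (Or.inr hI))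
  left
  obtain ⟨c, hc, hc0⟩ := Submodule.exists_mem_ne_zero_of_ne_bot hI
  obtain ⟨b, hb⟩ := hK.mul_inv_cancel (fun h => hc0 (hA c hc h))
  obtain ⟨e, he, he2⟩ : ∃ e ∈ I, e.coeff 2 = 1 :=
    ⟨const b * c, I.mul_mem_left _ hc, by simp [mul_comm b _, hb]⟩
  -- For the `e ∈ I` with `y²`-coefficient `1`, `y e` and `θ(e₁)e` have equal `y²`-coefficients,
  -- hence coincide. The other coefficients give `θ(e₁)e₀ = 1` and `θ(e₀) = θ(e₁)e₁`, so `α = θ(e₁)`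
  -- works.
  have hye := hA (y * e - const (θ.1 (e.coeff 1)) * e)
    (I.sub_mem (I.mul_mem_left _ he) (I.mul_mem_left _ he)) (by simp [he2])
  have h0 := congrArg (fun v => v.coeff 0) hye
  have h1 := congrArg (fun v => v.coeff 1) hye
  simp [he2] at h0 h1
  have h0' := sub_eq_zero.1 h0
  have hinv : (((Units.mkOfMulEqOne _ _ h0'.symm)⁻¹ : Kˣ) : K) = e.coeff 0 := rfl
  refine ⟨Units.mkOfMulEqOne _ _ h0'.symm, ?_, ?_⟩
  · simp only [Units.val_mkOfMulEqOne, theta_theta_theta]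
    have h2 := congrArg θ.1 h0
    simp at h2
    linear_combination (- θ.1 (θ.1 (e.coeff 1))) * h1 - h2
  · apply le_antisymm
    · intro v hv
      have := hA (v - const (v.coeff 2) * e) (I.sub_mem hv (I.mul_mem_left _ he)) (by simp [he2])
      rw [sub_eq_zero.1 this]
      refine Ideal.mem_span_singleton'.2 ⟨const (v.coeff 2), ?_⟩
      congr 1
      rw [pow_two]
      apply ext3 <;> simp [he2, theta_theta_theta, hinv]
    · rw [Ideal.span_singleton_le_iff_mem]
      convert he using 1
      rw [pow_two]
      apply ext3 <;> simp [he2, theta_theta_theta, hinv]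

/-- The rows are the coefficient vectors of `y - α` and `y(y - α)`. -/
theorem isGeneratorMatrix_y_sub {α : K} (hα : α * θ.1 α * θ.1 (θ.1 α) = 1) :
    IsGeneratorMatrix !![-α, 1, 0; 0, -θ.1 α, 1]
      (Ideal.span {(-const α + y : SkewCyclic K θ)}) := by
  constructor
  · rw [Fintype.linearIndependent_iff]
    intro g hg
    have h0 := congrFun hg 0
    have h1 := congrFun hg 1
    have h2 := congrFun hg 2
    simp [Fin.sum_univ_two] at h0 h1 h2
    have h3 : g 0 = 0 := by simpa [h2] using h1
    intro i
    fin_cases i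
    · exact h3
    · exact h2
  · intro v
    rw [mem_span_y_sub_iff hα, Submodule.mem_span_range_iff_exists_fun]
    constructor
    · intro h
      refine ⟨![v.coeff 1 + v.coeff 2 * θ.1 α, v.coeff 2], ?_⟩
      ext k
      fin_cases k <;> simp [Fin.sum_univ_two]
      linear_combination -h
    · rintro ⟨c, hc⟩
      rw [← hc]
      simp [Fin.sum_univ_two]
      ring

theorem isGeneratorMatrix_quadratic [Nontrivial K] {α : Kˣ}
    (hα : (α : K) * θ.1 α * θ.1 (θ.1 α) = 1) :
    IsGeneratorMatrix !![((α⁻¹ : Kˣ) : K), θ.1 (θ.1 α), 1] (Ideal.span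
      {(const ((α⁻¹ : Kˣ) : K) + const (θ.1 (θ.1 α)) * y + y ^ 2 : SkewCyclic K θ)}) := by
  constructor
  · rw [Fintype.linearIndependent_iff]
    intro g hg i
    have h2 := congrFun hg 2
    fin_cases i
    simpa using h2
  · intro v
    rw [mem_span_quadratic_iff hα, Submodule.mem_span_range_iff_exists_fun]
    constructor
    · rintro ⟨h0, h1⟩
      refine ⟨![v.coeff 2], ?_⟩
      ext k
      fin_cases k <;> simp [h0, h1]
    · rintro ⟨c, hc⟩
      rw [← hc]
      simp

/-! ### The anti-homomorphism `star` and annihilators in the noncommutative case. -/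

section Star

variable {K' : Type*} [CommRing K'] {θ' : CubicEndo K'}

/-- The map `∑ aᵢ yⁱ ↦ ∑ y⁻ⁱ μ(aᵢ)` induced by a ring homomorphism `μ`. -/
def star (θ' : CubicEndo K') (μ : K →+* K') (c : SkewCyclic K θ) : SkewCyclic K' θ' :=
  ⟨![μ (c.coeff 0), θ'.1 (μ (c.coeff 2)), θ'.1 (θ'.1 (μ (c.coeff 1)))]⟩

@[simp] theorem star_coeff_zero (μ : K →+* K') (c : SkewCyclic K θ) :
    (star θ' μ c).coeff 0 = μ (c.coeff 0) := rfl
@[simp] theorem star_coeff_one (μ : K →+* K') (c : SkewCyclic K θ) :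
    (star θ' μ c).coeff 1 = θ'.1 (μ (c.coeff 2)) := rfl
@[simp] theorem star_coeff_two (μ : K →+* K') (c : SkewCyclic K θ) :
    (star θ' μ c).coeff 2 = θ'.1 (θ'.1 (μ (c.coeff 1))) := rfl

theorem star_add (μ : K →+* K') (a b : SkewCyclic K θ) :
    star θ' μ (a + b) = star θ' μ a + star θ' μ b := by
  apply ext3 <;> simp

theorem star_zero (μ : K →+* K') : star θ' μ (0 : SkewCyclic K θ) = 0 := by
  apply ext3 <;> simp

theorem star_one (μ : K →+* K') : star θ' μ (1 : SkewCyclic K θ) = 1 := by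
  apply ext3 <;> simp

/-- Replacing `y` by `y⁻¹` reverses products, and the compatibility of `μ` with `θ` and `θ'`
preserves the commutation rule. -/
theorem star_mul {μ : K →+* K'} (hμ : ∀ a, μ (θ.1 a) = θ'.1 (μ a)) (a b : SkewCyclic K θ) :
    star θ' μ (a * b) = star θ' μ b * star θ' μ a := by
  apply ext3 <;> simp [hμ, theta_theta_theta] <;> ring

/-- The left annihilator of `y² - b`, the `star` of `y - α`. -/
theorem mul_sq_sub_eq_zero_iff {b : K} {β : Kˣ} (hb : b * θ.1 b * θ.1 (θ.1 b) = 1)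
    (hβ : θ.1 (θ.1 b) * β = 1) (d : SkewCyclic K θ) :
    d * (y ^ 2 - const b) = 0 ↔
      d ∈ Ideal.span {const ((β⁻¹ : Kˣ) : K) + const (θ.1 (θ.1 β)) * y + y ^ 2} := by
  have h1 : b * θ.1 β = 1 := by simpa [theta_theta_theta] using congrArg θ.1 hβ
  have h2 : θ.1 b * θ.1 (θ.1 β) = 1 := by simpa using congrArg θ.1 h1
  -- `β` is the inverse of a conjugate of `b`, so its norm is the inverse of the norm of `b`.
  have hN : (β : K) * θ.1 β * θ.1 (θ.1 β) = 1 := by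
    linear_combination (-(β : K) * θ.1 β * θ.1 (θ.1 β)) * hb + hβ +
      (θ.1 (θ.1 b) * β) * h1 + (θ.1 (θ.1 b) * β * b * θ.1 β) * h2
  have hinv : ((β⁻¹ : Kˣ) : K) = θ.1 (θ.1 b) :=
    Units.inv_eq_of_mul_eq_one_right (by rw [mul_comm]; exact hβ)
  rw [mem_span_quadratic_iff hN, hinv, pow_two]
  constructor
  · intro h
    have e0 := congrArg (fun v => v.coeff 0) h
    have e1 := congrArg (fun v => v.coeff 1) h
    have e2 := congrArg (fun v => v.coeff 2) h
    simp at e0 e1 e2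
    constructor
    · linear_combination e2
    · linear_combination (-θ.1 (θ.1 β)) * e1 - d.coeff 1 * h2
  · rintro ⟨e0, e1⟩
    apply ext3 <;> simp [e0, e1]
    · linear_combination d.coeff 2 * θ.1 (θ.1 b) * b * h2 - d.coeff 2 * θ.1 (θ.1 β) * hb
    · linear_combination (-d.coeff 2) * h2

/-- The left annihilator of the `star` of `α⁻¹ + θ²(α) y + y²`. -/
theorem mul_quadratic_eq_zero_iff {b b' : K} {β : Kˣ} (hb : b * θ.1 b * θ.1 (θ.1 b) = 1)
    (hb' : b * b' = 1) (hβ : θ.1 b * β = 1) (d : SkewCyclic K θ) :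
    d * (const b' + y + const (θ.1 b) * y ^ 2) = 0 ↔ d ∈ Ideal.span {-const (β : K) + y} := by
  have h1 : θ.1 (θ.1 b) * θ.1 β = 1 := by simpa using congrArg θ.1 hβ
  have h2 : b * θ.1 (θ.1 β) = 1 := by simpa [theta_theta_theta] using congrArg θ.1 h1
  have hN : (β : K) * θ.1 β * θ.1 (θ.1 β) = 1 := by
    linear_combination (-(β : K) * θ.1 β * θ.1 (θ.1 β)) * hb + hβ +
      (θ.1 b * β) * h1 + (θ.1 b * β * θ.1 (θ.1 b) * θ.1 β) * h2
  -- Since `b' = b⁻¹` and `β = θ(b)⁻¹`, the norm relation writes every conjugate occurring in the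
  -- product in terms of `b`, `b'`, `β` and `θ(b)`. All three coefficient equations then become
  -- multiples of the single linear condition for `y - β`.
  have hb1 : θ.1 b' = β := by
    have h := congrArg θ.1 hb'
    simp only [map_mul, map_one] at h
    linear_combination (β : K) * h - θ.1 b' * hβ
  have hb2 : (β : K) * θ.1 β = b := by
    linear_combination (-(β : K) * θ.1 β) * hb + b * θ.1 b * β * h1 + b * hβ
  have hb3 : θ.1 (θ.1 b) = b' * β := by
    linear_combination b' * β * hb - θ.1 (θ.1 b) * θ.1 b * β * hb' - θ.1 (θ.1 b) * hβ
  have hb4 : θ.1 β = θ.1 b * b := by linear_combination b * θ.1 b * h1 - θ.1 β * hb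
  rw [mem_span_y_sub_iff hN, hb2, pow_two]
  constructor
  · intro h
    have e1 := congrArg (fun v => v.coeff 1) h
    simp [hb1, theta_theta_theta] at e1
    linear_combination e1
  · intro h
    apply ext3 <;> simp [hb1, theta_theta_theta]
    · linear_combination b' * h - d.coeff 2 * hb' + d.coeff 1 * hb3
    · linear_combination h
    · linear_combination θ.1 b * h - d.coeff 1 * hβ + d.coeff 2 * hb4

end Star

end SkewCyclic

/-- Peels one known prime off a product; used to list all divisors of `X³ - 1`. -/
theorem dvd_mul_prime_cases {M : Type*} [CommMonoidWithZero M] [IsCancelMulZero M] {p a b : M}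
    (ha : Prime a) (h : p ∣ a * b) : p ∣ b ∨ ∃ p', p' ∣ b ∧ p = a * p' := by
  obtain ⟨c, hc⟩ := h
  rcases ha.dvd_or_dvd (Dvd.intro _ hc) with ⟨p', rfl⟩ | ⟨c', rfl⟩
  · refine Or.inr ⟨p', ⟨c, mul_left_cancel₀ ha.ne_zero ?_⟩, rfl⟩
    rw [hc, mul_assoc]
  · refine Or.inl ⟨c', mul_left_cancel₀ ha.ne_zero ?_⟩
    rw [hc, mul_left_comm]

namespace SkewCyclic

/-- As `star (a g) = star g * star a`, an element killing `star g` from the left kills the star of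
every left multiple of `g`. -/
theorem mem_iff_of_eq_span {K K' : Type*} [CommRing K] [CommRing K'] {θ : CubicEndo K}
    {θ' : CubicEndo K'} {μ : K →+* K'} (hμ : ∀ a, μ (θ.1 a) = θ'.1 (μ a))
    {C : Ideal (SkewCyclic K θ)} {D : Ideal (SkewCyclic K' θ')}
    (hD : ∀ d, d ∈ D ↔ ∀ c ∈ C, d * star θ' μ c = 0) {g : SkewCyclic K θ} (hg : C = Ideal.span {g})
    (d : SkewCyclic K' θ') : d ∈ D ↔ d * star θ' μ g = 0 := by
  rw [hD]
  constructor
  · exact fun h => h g (hg ▸ Ideal.mem_span_singleton_self g)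
  · intro h c hc
    rw [hg] at hc
    obtain ⟨a, rfl⟩ := Ideal.mem_span_singleton'.1 hc
    rw [star_mul hμ, ← mul_assoc, h, zero_mul]

/-! ### The case `θ = id`: divisors of `y³ - 1` and reciprocal polynomials. -/

section Commutative

variable {K : Type*} [Field K] {θ : CubicEndo K}

theorem mul_comm_of_theta_eq (hθ : ∀ a, θ.1 a = a) (a b : SkewCyclic K θ) : a * b = b * a := by
  apply ext3 <;> simp [hθ] <;> ring

/-- Evaluation of polynomials at `y`. -/
def evalY (hθ : ∀ a, θ.1 a = a) : K[X] →+* SkewCyclic K θ :=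
  eval₂RingHom' (constHom θ) y fun _ => mul_comm_of_theta_eq hθ _ _

theorem evalY_X (hθ : ∀ a, θ.1 a = a) : evalY hθ X = y :=
  eval₂_X _ _

theorem evalY_C (hθ : ∀ a, θ.1 a = a) (a : K) : evalY hθ (C a) = const a :=
  eval₂_C _ _

theorem evalY_surjective (hθ : ∀ a, θ.1 a = a) : Function.Surjective (evalY hθ) := by
  intro c
  refine ⟨C (c.coeff 0) + C (c.coeff 1) * X + C (c.coeff 2) * X ^ 2, ?_⟩
  simp only [map_add, map_mul, map_pow, evalY_X, evalY_C]
  exact (eq_const_add c).symm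

/-- Division by the monic `X³ - 1` leaves degree below `3`, where the coefficients can be read off
at `y`. This makes the ring `K[X]/⟨X³ - 1⟩`. -/
theorem evalY_eq_zero_iff (hθ : ∀ a, θ.1 a = a) (p : K[X]) :
    evalY hθ p = 0 ↔ X ^ 3 - 1 ∣ p := by
  have hm : (X ^ 3 - 1 : K[X]).Monic := by
    simpa using monic_X_pow_sub_C (1 : K) (three_ne_zero)
  have h0 : evalY hθ (X ^ 3 - 1) = 0 := by
    rw [map_sub, map_pow, evalY_X, map_one, y_pow_three, sub_self]
  constructor
  · intro h
    rw [← modByMonic_eq_zero_iff_dvd hm]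
    have h1 : evalY hθ (p %ₘ (X ^ 3 - 1)) = 0 := by
      rw [modByMonic_eq_sub_mul_div, map_sub, map_mul, h0, zero_mul, h, sub_zero]
    have h3 : (X ^ 3 - 1 : K[X]).natDegree = 3 := by
      simpa using natDegree_X_pow_sub_C (n := 3) (r := (1 : K))
    have hd : (p %ₘ (X ^ 3 - 1)).natDegree < 3 := by
      refine (natDegree_modByMonic_lt p hm fun h => ?_).trans_eq h3
      rw [h, natDegree_one] at h3
      omega
    set s := p %ₘ (X ^ 3 - 1)
    rw [s.as_sum_range' 3 hd] at h1 ⊢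
    simp only [Finset.sum_range_succ, Finset.sum_range_zero, ← C_mul_X_pow_eq_monomial, map_add,
      map_mul, map_pow, evalY_X, evalY_C, pow_zero, pow_one, mul_one, zero_add] at h1 ⊢
    have e0 := congrArg (fun v => v.coeff 0) h1
    have e1 := congrArg (fun v => v.coeff 1) h1
    have e2 := congrArg (fun v => v.coeff 2) h1
    simp [pow_two] at e0 e1 e2
    simp [e0, e1, e2]
  · rintro ⟨c, rfl⟩
    rw [map_mul, h0, zero_mul]

/-- The preimage of `I` in the principal ideal domain `K[X]` contains `X³ - 1`, so its generator
divides it. -/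
theorem exists_eq_span_evalY (hθ : ∀ a, θ.1 a = a) (I : Ideal (SkewCyclic K θ)) :
    ∃ p : K[X], p ∣ X ^ 3 - 1 ∧ I = Ideal.span {evalY hθ p} := by
  obtain ⟨p, hp⟩ := IsPrincipalIdealRing.principal (I.comap (evalY hθ))
  rw [Ideal.submodule_span_eq] at hp
  refine ⟨p, ?_, ?_⟩
  · rw [← Ideal.mem_span_singleton, ← hp, Ideal.mem_comap,
      (evalY_eq_zero_iff hθ _).2 dvd_rfl]
    exact Submodule.zero_mem _
  · rw [← Ideal.map_comap_of_surjective _ (evalY_surjective hθ) I, hp, Ideal.map_span,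
      Set.image_singleton]

theorem span_evalY_eq_of_associated (hθ : ∀ a, θ.1 a = a) {p p' : K[X]} (h : Associated p p') :
    Ideal.span {evalY hθ p} = Ideal.span {evalY hθ p'} := by
  have key : ∀ {a b : K[X]}, a ∣ b → Ideal.span {evalY hθ b} ≤ Ideal.span {evalY hθ a} := by
    rintro a _ ⟨c, rfl⟩
    rw [Ideal.span_singleton_le_iff_mem, mul_comm, map_mul]
    exact Ideal.mul_mem_left _ _ (Ideal.mem_span_singleton_self _)
  exact le_antisymm (key h.dvd') (key h.dvd)

/-- Lifted to `K[X]`, the left side reads `kh ∣ ph`, and `h` cancels. -/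
theorem mul_evalY_eq_zero_iff (hθ : ∀ a, θ.1 a = a) {k h : K[X]} (hkh : k * h = X ^ 3 - 1)
    (d : SkewCyclic K θ) : d * evalY hθ h = 0 ↔ d ∈ Ideal.span {evalY hθ k} := by
  have h0 : (X ^ 3 - 1 : K[X]) ≠ 0 := by
    simpa using X_pow_sub_C_ne_zero (three_pos) (1 : K)
  constructor
  · intro hd
    obtain ⟨p, rfl⟩ := evalY_surjective hθ d
    rw [← map_mul, evalY_eq_zero_iff, ← hkh] at hd
    have := (mul_dvd_mul_iff_right (fun h1 => h0 (by rw [← hkh, h1, mul_zero]))).1 hd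
    obtain ⟨c, rfl⟩ := this
    rw [mul_comm, map_mul]
    exact Ideal.mul_mem_left _ _ (Ideal.mem_span_singleton_self _)
  · intro hd
    obtain ⟨c, rfl⟩ := Ideal.mem_span_singleton'.1 hd
    rw [mul_assoc, ← map_mul, hkh, (evalY_eq_zero_iff hθ _).2 dvd_rfl, mul_zero]

variable {K' : Type*} [Field K'] {θ' : CubicEndo K'} {μ : K →+* K'}

/-- `g` and its reciprocal polynomial: `star g` is a unit times `h(y)`. -/
def IsReciprocal (hθ' : ∀ a, θ'.1 a = a) (μ : K →+* K') (g : SkewCyclic K θ) (h : K'[X]) : Prop :=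
  ∃ u, IsUnit u ∧ star θ' μ g = evalY hθ' h * u

variable {hθ' : ∀ a, θ'.1 a = a}

theorem IsReciprocal.mul (hμ : ∀ a, μ (θ.1 a) = θ'.1 (μ a)) {g₁ g₂ : SkewCyclic K θ} {h₁ h₂ : K'[X]}
    (H₁ : IsReciprocal hθ' μ g₁ h₁) (H₂ : IsReciprocal hθ' μ g₂ h₂) :
    IsReciprocal hθ' μ (g₁ * g₂) (h₁ * h₂) := by
  obtain ⟨u₁, hu₁, e₁⟩ := H₁
  obtain ⟨u₂, hu₂, e₂⟩ := H₂
  refine ⟨u₂ * u₁, hu₂.mul hu₁, ?_⟩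
  rw [star_mul hμ, e₁, e₂, mul_comm h₁, map_mul, mul_assoc, mul_assoc, ← mul_assoc u₂,
    mul_comm_of_theta_eq hθ' u₂, mul_assoc]

theorem IsReciprocal.one : IsReciprocal hθ' μ (1 : SkewCyclic K θ) 1 :=
  ⟨1, isUnit_one, by rw [star_one, map_one, mul_one]⟩

theorem isUnit_y : IsUnit (y : SkewCyclic K θ) :=
  IsUnit.of_pow_eq_one y_pow_three three_ne_zero

/-- `y⁻¹ - μ(a) = -μ(a)y²(y - μ(a)⁻¹)`, using `y⁻¹ = y²`. -/
theorem isReciprocal_y_sub_const {a : K} {b : K'} (hab : μ a * b = 1) :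
    IsReciprocal hθ' μ (y - const a : SkewCyclic K θ) (X - C b) := by
  refine ⟨const (-μ a) * y ^ 2, ?_, ?_⟩
  · refine IsUnit.mul ?_ (isUnit_y.pow 2)
    exact (IsUnit.mk0 (-μ a) (neg_ne_zero.2 (left_ne_zero_of_mul_eq_one hab))).map (constHom θ')
  · rw [map_sub, evalY_X, evalY_C, pow_two]
    apply ext3 <;> simp [hθ']
    linear_combination -hab

theorem isReciprocal_y_sub_one : IsReciprocal hθ' μ (y - 1 : SkewCyclic K θ) (X - 1) := by
  have h := isReciprocal_y_sub_const (θ := θ) (hθ' := hθ') (μ := μ) (a := 1) (b := 1) (by simp)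
  rwa [const_one, C_1] at h

theorem isReciprocal_y_sq_add : IsReciprocal hθ' μ (y ^ 2 + y + 1 : SkewCyclic K θ)
    (X ^ 2 + X + 1) := by
  refine ⟨1, isUnit_one, ?_⟩
  simp only [map_add, map_pow, evalY_X, map_one]
  rw [pow_two, pow_two]
  apply ext3 <;> simp [hθ']

theorem isReciprocal_y_cube_sub_one : IsReciprocal hθ' μ (y ^ 3 - 1 : SkewCyclic K θ)
    (X ^ 3 - 1) := by
  refine ⟨1, isUnit_one, ?_⟩
  rw [y_pow_three, sub_self, star_zero, (evalY_eq_zero_iff hθ' _).2 dvd_rfl, zero_mul]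

/-- For `C = R g`, the left annihilator of `star C` is generated by `h`. -/
def IsDualPair (θ' : CubicEndo K') (μ : K →+* K') (p : SkewCyclic K θ × SkewCyclic K' θ') : Prop :=
  ∀ d, d * star θ' μ p.1 = 0 ↔ d ∈ Ideal.span {p.2}

theorem IsReciprocal.isDualPair {g : SkewCyclic K θ} {h : K'[X]} {g' : SkewCyclic K' θ'}
    (H : IsReciprocal hθ' μ g h) (k : K'[X]) (hkh : k * h = X ^ 3 - 1) (hk : evalY hθ' k = g') :
    IsDualPair θ' μ (g, g') := by
  intro d
  obtain ⟨u, hu, e⟩ := H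
  rw [← hk, e, ← mul_assoc, hu.mul_left_eq_zero]
  exact mul_evalY_eq_zero_iff hθ' hkh d

theorem eq_span_of_isDualPair (hμ : ∀ a, μ (θ.1 a) = θ'.1 (μ a))
    {C : Ideal (SkewCyclic K θ)} {D : Ideal (SkewCyclic K' θ')}
    (hD : ∀ d, d ∈ D ↔ ∀ c ∈ C, d * star θ' μ c = 0) {p : SkewCyclic K θ × SkewCyclic K' θ'}
    (hp : IsDualPair θ' μ p) (hC : C = Ideal.span {p.1}) : D = Ideal.span {p.2} := by
  ext d
  rw [mem_iff_of_eq_span hμ hD hC, hp d]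

theorem mul_quadratic (R : Type*) [CommRing R] :
    ((X - 1) * (X ^ 2 + X + 1) : R[X]) = X ^ 3 - 1 := by ring

theorem isDualPair_cases_two (hθ' : ∀ a, θ'.1 a = a) (p : SkewCyclic K θ × SkewCyclic K' θ')
    (hp : p ∈ ({(1, y ^ 3 - 1), (y - 1, y ^ 2 + y + 1), (y ^ 2 + y + 1, y - 1), (y ^ 3 - 1, 1)} :
      Set (SkewCyclic K θ × SkewCyclic K' θ'))) : IsDualPair θ' μ p := by
  simp only [Set.mem_insert_iff, Set.mem_singleton_iff] at hp
  rcases hp with rfl | rfl | rfl | rfl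
  · exact (IsReciprocal.one (hθ' := hθ')).isDualPair (X ^ 3 - 1) (mul_one _) (by simp [evalY_X])
  · exact (isReciprocal_y_sub_one (hθ' := hθ')).isDualPair
      (X ^ 2 + X + 1)
      (by rw [mul_comm]; exact mul_quadratic K') (by simp [evalY_X])
  · exact (isReciprocal_y_sq_add (hθ' := hθ')).isDualPair (X - 1) (mul_quadratic K')
      (by simp [evalY_X])
  · exact (isReciprocal_y_cube_sub_one (hθ' := hθ')).isDualPair
      1 (one_mul _) (map_one _)

theorem isDualPair_cases_zero (hμ : ∀ a, μ (θ.1 a) = θ'.1 (μ a)) (hθ' : ∀ a, θ'.1 a = a)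
    (h3 : (3 : K') = 0) (p : SkewCyclic K θ × SkewCyclic K' θ')
    (hp : p ∈ ({(1, (y - 1) ^ 3), (y - 1, (y - 1) ^ 2), ((y - 1) ^ 2, y - 1), ((y - 1) ^ 3, 1)} :
      Set (SkewCyclic K θ × SkewCyclic K' θ'))) : IsDualPair θ' μ p := by
  have hC : (3 : K'[X]) = 0 := by
    rw [← C_ofNat, h3, C_0]
  -- The two sides differ by `3(X - X²)`.
  have hcube : ((X - 1) ^ 3 : K'[X]) = X ^ 3 - 1 := by linear_combination (X - X ^ 2) * hC
  have H := isReciprocal_y_sub_one (θ := θ) (hθ' := hθ') (μ := μ)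
  have H2 : IsReciprocal hθ' μ ((y - 1) ^ 2 : SkewCyclic K θ) ((X - 1) ^ 2) := by
    rw [pow_two, pow_two]
    exact H.mul hμ H
  have H3 : IsReciprocal hθ' μ ((y - 1) ^ 3 : SkewCyclic K θ) ((X - 1) ^ 3) := by
    rw [pow_succ, pow_succ (X - 1)]
    exact H2.mul hμ H
  simp only [Set.mem_insert_iff, Set.mem_singleton_iff] at hp
  rcases hp with rfl | rfl | rfl | rfl
  · exact (IsReciprocal.one (hθ' := hθ')).isDualPair
      ((X - 1) ^ 3) (by rw [mul_one, hcube]) (by simp [evalY_X])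
  · exact H.isDualPair ((X - 1) ^ 2) (by rw [← hcube]; ring) (by simp [evalY_X])
  · exact H2.isDualPair (X - 1) (by rw [← hcube]; ring) (by simp [evalY_X])
  · exact H3.isDualPair 1 (by rw [← hcube, one_mul]) (map_one _)

theorem mul_of_isRoot {R : Type*} [CommRing R] {w : R} (hw : w ^ 2 + w + 1 = 0) :
    ((X - C w) * (X - C (w ^ 2)) : R[X]) = X ^ 2 + X + 1 := by
  have h : C w ^ 2 + C w + 1 = 0 := by rw [← C_pow, ← C_add, ← C_1, ← C_add, hw, C_0]
  rw [C_pow]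
  linear_combination (C w - X - 1) * h

theorem isDualPair_cases_one (hμ : ∀ a, μ (θ.1 a) = θ'.1 (μ a)) (hθ' : ∀ a, θ'.1 a = a)
    {w : K} (hw : w ^ 2 + w + 1 = 0)
    (p : SkewCyclic K θ × SkewCyclic K' θ')
    (hp : p ∈ ({(1, y ^ 3 - 1), (y - 1, y ^ 2 + y + 1),
      (y - const w, (y - 1) * (y - const (μ w))),
      (y - const (w ^ 2), (y - 1) * (y - const (μ w ^ 2))),
      (y ^ 2 + y + 1, y - 1),
      ((y - 1) * (y - const (w ^ 2)), y - const (μ w ^ 2)),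
      ((y - 1) * (y - const w), y - const (μ w)),
      (y ^ 3 - 1, 1)} : Set (SkewCyclic K θ × SkewCyclic K' θ'))) : IsDualPair θ' μ p := by
  have hw' : μ w ^ 2 + μ w + 1 = 0 := by simpa using congrArg μ hw
  have hw3 : μ w * μ w ^ 2 = 1 := by linear_combination (μ w - 1) * hw'
  have hQ := mul_of_isRoot hw'
  have hX := mul_quadratic K'
  rw [← hQ] at hX
  have H := isReciprocal_y_sub_one (θ := θ) (hθ' := hθ') (μ := μ)
  -- The inverse of `ω'` is `ω'²`, so passing to reciprocals exchanges the two primitive cube roots.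
  -- Complementing in `X³ - 1` exchanges them back, so `y - ω` is paired with `(y - 1)(y - ω')`.
  have H1 := isReciprocal_y_sub_const (θ := θ) (hθ' := hθ') (μ := μ) (a := w) hw3
  have H2 := isReciprocal_y_sub_const (θ := θ) (hθ' := hθ') (μ := μ) (a := w ^ 2) (b := μ w)
    (by rw [map_pow, mul_comm, hw3])
  simp only [Set.mem_insert_iff, Set.mem_singleton_iff] at hp
  rcases hp with rfl | rfl | rfl | rfl | rfl | rfl | rfl | rfl
  · exact isDualPair_cases_two hθ' _ (by simp)
  · exact isDualPair_cases_two hθ' _ (by simp)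
  · exact H1.isDualPair ((X - 1) * (X - C (μ w))) (by rw [← hX]; ring)
      (by simp only [map_mul, map_sub, map_one, evalY_X, evalY_C])
  · exact H2.isDualPair ((X - 1) * (X - C (μ w ^ 2))) (by rw [← hX]; ring)
      (by simp only [map_mul, map_sub, map_one, evalY_X, evalY_C])
  · exact isDualPair_cases_two hθ' _ (by simp)
  · exact (H.mul hμ H2).isDualPair (X - C (μ w ^ 2)) (by rw [← hX]; ring)
      (by simp only [map_sub, evalY_X, evalY_C])
  · exact (H.mul hμ H1).isDualPair (X - C (μ w)) (by rw [← hX]; ring)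
      (by simp only [map_sub, evalY_X, evalY_C])
  · exact isDualPair_cases_two hθ' _ (by simp)

theorem ideal_cases_of_prime_quadratic (hθ : ∀ a, θ.1 a = a)
    (hQ : ∀ a : K, a ^ 2 + a + 1 ≠ 0) (I : Ideal (SkewCyclic K θ)) :
    I = Ideal.span {1} ∨ I = Ideal.span {y - 1} ∨ I = Ideal.span {y ^ 2 + y + 1} ∨
      I = Ideal.span {y ^ 3 - 1} := by
  obtain ⟨p, hp, rfl⟩ := exists_eq_span_evalY hθ I
  have hdeg : (X ^ 2 + X + 1 : K[X]).natDegree = 2 := by compute_degree!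
  have hirr : Irreducible (X ^ 2 + X + 1 : K[X]) := by
    refine irreducible_of_degree_le_three_of_not_isRoot (by rw [hdeg]; decide) fun a ha => hQ a ?_
    simpa using ha
  have hcase : ∀ p : K[X], p ∣ X ^ 2 + X + 1 → Associated p 1 ∨ Associated p (X ^ 2 + X + 1) :=
    fun p hp => (hirr.dvd_iff.1 hp).imp associated_one_iff_isUnit.2 Associated.symm
  have key : Associated p 1 ∨ Associated p (X - 1) ∨ Associated p (X ^ 2 + X + 1) ∨
      Associated p (X ^ 3 - 1) := by
    rw [← mul_quadratic] at hp ⊢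
    have hprime : Prime (X - 1 : K[X]) := by simpa using prime_X_sub_C (1 : K)
    rcases dvd_mul_prime_cases hprime hp with h | ⟨p', hp', rfl⟩
    · rcases hcase p h with h | h <;> simp [h]
    · rcases hcase p' hp' with h | h
      · right; left
        simpa using h.mul_left (X - 1)
      · right; right; right
        exact h.mul_left (X - 1)
  rcases key with h | h | h | h <;> have h' := span_evalY_eq_of_associated hθ h <;>
    simp only [map_add, map_sub, map_pow, map_one, evalY_X] at h'
  · exact Or.inl h'
  · exact Or.inr (Or.inl h')
  · exact Or.inr (Or.inr (Or.inl h'))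
  · exact Or.inr (Or.inr (Or.inr h'))

theorem ideal_cases_of_three_eq_zero (hθ : ∀ a, θ.1 a = a) (h3 : (3 : K) = 0)
    (I : Ideal (SkewCyclic K θ)) : ∃ k ≤ 3, I = Ideal.span {(y - 1) ^ k} := by
  obtain ⟨p, hp, rfl⟩ := exists_eq_span_evalY hθ I
  have hC : (3 : K[X]) = 0 := by
    rw [← C_ofNat, h3, C_0]
  have hcube : ((X - 1) ^ 3 : K[X]) = X ^ 3 - 1 := by linear_combination (X - X ^ 2) * hC
  have hprime : Prime (X - 1 : K[X]) := by simpa using prime_X_sub_C (1 : K)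
  rw [← hcube] at hp
  obtain ⟨k, hk, h⟩ := (dvd_prime_pow hprime 3).1 hp
  refine ⟨k, hk, ?_⟩
  rw [span_evalY_eq_of_associated hθ h]
  simp [evalY_X]

theorem ideal_cases_of_root (hθ : ∀ a, θ.1 a = a) {w : K} (hw : w ^ 2 + w + 1 = 0)
    (I : Ideal (SkewCyclic K θ)) :
    I = Ideal.span {1} ∨ I = Ideal.span {y - 1} ∨ I = Ideal.span {y - const w} ∨
      I = Ideal.span {y - const (w ^ 2)} ∨ I = Ideal.span {y ^ 2 + y + 1} ∨
      I = Ideal.span {(y - 1) * (y - const (w ^ 2))} ∨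
      I = Ideal.span {(y - 1) * (y - const w)} ∨ I = Ideal.span {y ^ 3 - 1} := by
  obtain ⟨p, hp, rfl⟩ := exists_eq_span_evalY hθ I
  have hcase : ∀ p : K[X], p ∣ X ^ 2 + X + 1 → Associated p 1 ∨ Associated p (X - C w) ∨
      Associated p (X - C (w ^ 2)) ∨ Associated p (X ^ 2 + X + 1) := by
    intro p hp
    have hi := (prime_X_sub_C (w ^ 2)).irreducible
    have hcase : ∀ p : K[X], p ∣ X - C (w ^ 2) → Associated p 1 ∨ Associated p (X - C (w ^ 2)) :=
      fun p hp => (hi.dvd_iff.1 hp).imp associated_one_iff_isUnit.2 Associated.symm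
    rw [← mul_of_isRoot hw] at hp ⊢
    rcases dvd_mul_prime_cases (prime_X_sub_C w) hp with h | ⟨p', hp', rfl⟩
    · rcases hcase p h with h | h <;> simp only [h, true_or, or_true]
    · rcases hcase p' hp' with h | h
      · right; left
        simpa using h.mul_left (X - C w)
      · right; right; right
        exact h.mul_left (X - C w)
  have key : Associated p 1 ∨ Associated p (X - 1) ∨ Associated p (X - C w) ∨
      Associated p (X - C (w ^ 2)) ∨ Associated p (X ^ 2 + X + 1) ∨
      Associated p ((X - 1) * (X - C (w ^ 2))) ∨ Associated p ((X - 1) * (X - C w)) ∨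
      Associated p (X ^ 3 - 1) := by
    rw [← mul_quadratic] at hp ⊢
    have hprime : Prime (X - 1 : K[X]) := by simpa using prime_X_sub_C (1 : K)
    rcases dvd_mul_prime_cases hprime hp with h | ⟨p', hp', rfl⟩
    · rcases hcase p h with h | h | h | h <;> simp only [h, true_or, or_true]
    · rcases hcase p' hp' with h | h | h | h <;> have h' := h.mul_left (X - 1) <;>
        try simp only [mul_one] at h'
      all_goals simp only [h', true_or, or_true]
  rcases key with h | h | h | h | h | h | h | h <;>
    have h' := span_evalY_eq_of_associated hθ h <;>
    rw [h'] <;>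
    simp only [map_add, map_sub, map_mul, map_one, evalY_X, evalY_C, map_pow (evalY hθ),
      true_or, or_true]

end Commutative

end SkewCyclic

/-! ### The finite fields `Kᵢ`, the automorphisms `θᵢ` and the groups `𝒢ᵢ`. -/

namespace MetacyclicData

variable {F L : Type*} [Field F] [Fintype F] [Field L] [Algebra F L] {P : MetacyclicData F L}

theorem Coset.monic_f (J : P.Coset) : J.f.Monic := by
  rw [← monic_map_iff (f := algebraMap F L), J.map_f]
  exact monic_prod_of_monic _ _ fun j _ => monic_X_sub_C _

theorem Coset.natDegree_f (J : P.Coset) : J.f.natDegree = J.d := by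
  rw [← natDegree_map (algebraMap F L), J.map_f, natDegree_prod_of_monic _ _
    fun j _ => monic_X_sub_C _]
  simp only [natDegree_X_sub_C, Finset.sum_const, smul_eq_mul, mul_one]
  rfl

theorem aeval_zeta_pow_eq_zero {p : F[X]} {a : L} (h : aeval a p = 0) (k : ℕ) :
    aeval (a ^ Fintype.card F ^ k) p = 0 := by
  induction k with
  | zero => simpa using h
  | succ k ih =>
    have h1 := congrArg (FiniteField.frobeniusAlgHom F L) ih
    rw [← aeval_algHom_apply, map_zero] at h1
    rwa [pow_succ, pow_mul]

/-- `fᵢ` is the minimal polynomial of `ζ^s` for a representative `s`: the minimal polynomial has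
coefficients in `F`, so Frobenius carries its root `ζ^s` to all the roots of `fᵢ`. -/
theorem Coset.irreducible_f (J : P.Coset) : Irreducible J.f := by
  obtain ⟨s, hs⟩ := J.2
  have hsJ : s ∈ J.1 := by
    rw [hs, mem_cyclotomicCoset]
    exact ⟨0, by simp⟩
  have hint : IsIntegral F (P.ζ ^ s.val) := ⟨J.f, J.monic_f, J.aeval_f hsJ⟩
  have h1 : minpoly F (P.ζ ^ s.val) ∣ J.f := minpoly.dvd _ _ (J.aeval_f hsJ)
  have h2 : J.f ∣ minpoly F (P.ζ ^ s.val) := by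
    refine J.f_dvd fun j hj => ?_
    rw [hs, mem_cyclotomicCoset] at hj
    obtain ⟨k, rfl⟩ := hj
    have h3 : s * (P.q : ZMod P.m) ^ k = ((Fintype.card F ^ k : ℕ) : ZMod P.m) * s := by
      simp [q, mul_comm]
    rw [h3, zeta_pow_val_natCast]
    exact aeval_zeta_pow_eq_zero (minpoly.aeval _ _) k
  exact (associated_of_dvd_dvd h1 h2).irreducible (minpoly.irreducible hint)

theorem Coset.fact_irreducible_f (J : P.Coset) : Fact (Irreducible J.f) := ⟨J.irreducible_f⟩

attribute [local instance] Coset.fact_irreducible_f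

theorem Coset.finrank_K (J : P.Coset) : Module.finrank F J.K = J.d := by
  rw [(AdjoinRoot.powerBasis J.monic_f.ne_zero).finrank, AdjoinRoot.powerBasis_dim, J.natDegree_f]

instance Coset.finite_module_K (J : P.Coset) : Module.Finite F J.K :=
  (AdjoinRoot.powerBasis J.monic_f.ne_zero).finite

instance Coset.finite_K (J : P.Coset) : Finite J.K := Module.finite_of_finite F

theorem Coset.card_K (J : P.Coset) : Nat.card J.K = P.q ^ J.d := by
  rw [Module.natCard_eq_pow_finrank (K := F), J.finrank_K, Nat.card_eq_fintype_card, q]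

theorem Coset.isField_K (J : P.Coset) : IsField J.K := Field.toIsField J.K

theorem Coset.theta_root (J : P.Coset) :
    J.theta.1 (AdjoinRoot.root J.f) = AdjoinRoot.root J.f ^ P.r :=
  AdjoinRoot.liftAlgHom_root _ _ _ (J.aeval_root_pow J P.r J.r_mul_mem)

theorem Coset.mu_root (J : P.Coset) :
    J.mu (AdjoinRoot.root J.f) = AdjoinRoot.root J.neg.f ^ (P.m - 1) :=
  AdjoinRoot.liftAlgHom_root _ _ _ (J.aeval_root_pow J.neg (P.m - 1) J.pred_mul_mem_neg)

theorem Coset.theta_of (J : P.Coset) (a : F) :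
    J.theta.1 (AdjoinRoot.of J.f a) = AdjoinRoot.of J.f a :=
  AdjoinRoot.liftAlgHom_of _ _ _ (J.aeval_root_pow J P.r J.r_mul_mem) _

theorem Coset.mu_of (J : P.Coset) (a : F) :
    J.mu (AdjoinRoot.of J.f a) = AdjoinRoot.of J.neg.f a :=
  AdjoinRoot.liftAlgHom_of _ _ _ (J.aeval_root_pow J.neg (P.m - 1) J.pred_mul_mem_neg) _

theorem Coset.ringHom_ext {J : P.Coset} {S : Type*} [Semiring S] {f g : J.K →+* S}
    (h1 : ∀ a, f (AdjoinRoot.of J.f a) = g (AdjoinRoot.of J.f a))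
    (h2 : f (AdjoinRoot.root J.f) = g (AdjoinRoot.root J.f)) (a : J.K) : f a = g a :=
  DFunLike.congr_fun (AdjoinRoot.ringHom_ext (RingHom.ext h1) h2) a

theorem Coset.mu_theta (J : P.Coset) (a : J.K) : J.mu (J.theta.1 a) = J.neg.theta.1 (J.mu a) := by
  refine Coset.ringHom_ext (f := J.mu.comp J.theta.1) (g := J.neg.theta.1.comp J.mu) ?_ ?_ a
  · intro a
    simp only [RingHom.comp_apply, theta_of, mu_of]
  · simp only [RingHom.comp_apply, theta_root, mu_root, map_pow]
    rw [← pow_mul, ← pow_mul, mul_comm]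

theorem Coset.frobenius_pow_apply (J : P.Coset) (n : ℕ) (a : J.K) :
    (FiniteField.frobeniusAlgHom F J.K ^ n) a = a ^ P.q ^ n := by
  rw [AlgHom.coe_pow, FiniteField.coe_frobeniusAlgHom, pow_iterate]
  rfl

/-- Both sides are `F`-algebra endomorphisms, and they agree on the root of `fᵢ` because `r ≡ q^ε`
modulo `m`. -/
theorem Coset.theta_eq_pow (J : P.Coset) (a : J.K) : J.theta.1 a = a ^ P.q ^ P.ε := by
  rw [← J.frobenius_pow_apply]
  refine Coset.ringHom_ext 
    (g := ((FiniteField.frobeniusAlgHom F J.K ^ P.ε : J.K →ₐ[F] J.K) : J.K →+* J.K)) ?_ ?_ a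
  · intro a
    rw [theta_of]
    exact ((FiniteField.frobeniusAlgHom F J.K ^ P.ε).commutes a).symm
  · rw [theta_root]
    refine Eq.trans ?_ (J.frobenius_pow_apply _ _).symm
    exact pow_eq_pow_of_modEq P.r_modEq J.root_pow_m

/-- `θ` is trivial iff `fᵢ` divides `X^r - X`, that is, iff `ζ^(rj) = ζ^j` for all `j` in the coset.
-/
theorem Coset.theta_eq_self_iff (J : P.Coset) : (∀ a, J.theta.1 a = a) ↔ J.IsFixed := by
  have hroot : (∀ a, J.theta.1 a = a) ↔
      AdjoinRoot.root J.f ^ P.r = AdjoinRoot.root J.f := by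
    rw [← J.theta_root]
    refine ⟨fun h => h _, fun h => ?_⟩
    exact Coset.ringHom_ext (g := RingHom.id J.K) J.theta_of h
  have hmk : AdjoinRoot.root J.f ^ P.r - AdjoinRoot.root J.f = AdjoinRoot.mk J.f (X ^ P.r - X) := by
    simp
  rw [hroot, ← sub_eq_zero, hmk, AdjoinRoot.mk_eq_zero]
  have hj (j : ZMod P.m) : aeval (P.ζ ^ j.val) (X ^ P.r - X : F[X]) = 0 ↔
      (P.r : ZMod P.m) * j = j := by
    rw [map_sub, map_pow, aeval_X, ← zeta_pow_val_natCast, sub_eq_zero]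
    refine ⟨fun h => ZMod.val_injective _ ?_, fun h => by rw [h]⟩
    exact P.isPrimitiveRoot.pow_inj (ZMod.val_lt _) (ZMod.val_lt _) h
  constructor
  · intro h j hjJ
    rw [← hj]
    exact aeval_eq_zero_of_dvd_aeval_eq_zero h (J.aeval_f hjJ)
  · exact fun h => J.f_dvd fun j hjJ => (hj j).2 (h j hjJ)

theorem Coset.isFixed_neg {J : P.Coset} : J.neg.IsFixed ↔ J.IsFixed := by
  simp [IsFixed, neg]

theorem Coset.d_neg (J : P.Coset) : J.neg.d = J.d :=
  Finset.card_image_of_injective _ neg_injective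

/-- Frobenius over `F` has order `[Kᵢ : F] = dᵢ`. -/
theorem Coset.pow_eq_self_iff (J : P.Coset) (n : ℕ) : (∀ a : J.K, a ^ P.q ^ n = a) ↔ J.d ∣ n := by
  rw [← J.finrank_K, ← FiniteField.orderOf_frobeniusAlgHom F J.K, orderOf_dvd_iff_pow_eq_one,
    AlgHom.ext_iff]
  simp only [J.frobenius_pow_apply, AlgHom.one_apply]

theorem Coset.not_d_dvd {J : P.Coset} (hJ : ¬ J.IsFixed) : ¬ J.d ∣ P.ε := by
  rw [← J.pow_eq_self_iff]
  simpa only [← J.theta_eq_pow, J.theta_eq_self_iff]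

theorem Coset.d_dvd_mul_three (J : P.Coset) : J.d ∣ P.ε * 3 := by
  rw [← J.pow_eq_self_iff]
  intro a
  have h := J.theta.2 a
  simp only [J.theta_eq_pow, ← pow_mul, ← pow_add] at h
  convert h using 2
  ring

/-- Here `d` divides `3ε` but not `ε`, which is impossible if `d` is prime to `3`. -/
theorem Coset.three_dvd_d {J : P.Coset} (hJ : ¬ J.IsFixed) : 3 ∣ J.d := by
  have h1 := not_d_dvd hJ
  have h2 := J.d_dvd_mul_three
  by_contra h3
  exact h1 (Nat.Coprime.dvd_of_dvd_mul_right
    ((Nat.prime_three.coprime_iff_not_dvd.2 h3).symm) h2)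

/-- On a coset that is not fixed, `θ` is the automorphism `a ↦ a ^ p` of order `3` or its inverse,
where `p = q ^ (d / 3)`. -/
theorem Coset.theta_cases {J : P.Coset} (hJ : ¬ J.IsFixed) :
    (∀ a, J.theta.1 a = a ^ P.q ^ (J.d / 3) ∧ J.theta.1 (J.theta.1 a) = a ^ P.q ^ (2 * J.d / 3)) ∨
    (∀ a, J.theta.1 a = a ^ P.q ^ (2 * J.d / 3) ∧
      J.theta.1 (J.theta.1 a) = a ^ P.q ^ (J.d / 3)) := by
  obtain ⟨e, he⟩ := three_dvd_d hJ
  have h1 := not_d_dvd hJ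
  have h2 := J.d_dvd_mul_three
  have hper : ∀ n k (a : J.K), a ^ P.q ^ (J.d * k + n) = a ^ P.q ^ n := by
    intro n k a
    rw [pow_add, pow_mul, (J.pow_eq_self_iff _).2 (Dvd.intro k rfl)]
  have h3 : J.d / 3 = e := by omega
  have h4 : 2 * J.d / 3 = 2 * e := by omega
  obtain ⟨k, hk⟩ : e ∣ P.ε := by
    rw [he, mul_comm 3 e] at h2
    exact Nat.dvd_of_mul_dvd_mul_right three_pos h2
  -- With `d = 3e` and `ε = ek`, only `k` modulo `3` matters. Residue `0` would make `θ` trivial,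
  -- and residues `1` and `2` are the two alternatives.
  have hk3 : k % 3 ≠ 0 := fun h => h1 <| by
    obtain ⟨c, rfl⟩ := Nat.dvd_of_mod_eq_zero h
    exact ⟨c, by rw [hk, he]; ring⟩
  have hθ : ∀ a, J.theta.1 a = a ^ P.q ^ (e * (k % 3)) := by
    intro a
    rw [J.theta_eq_pow, ← hper (e * (k % 3)) (k / 3), he, hk]
    congr 2
    conv_lhs => rw [← Nat.div_add_mod k 3]
    ring
  have hθθ : ∀ a, J.theta.1 (J.theta.1 a) = a ^ P.q ^ (2 * e * (k % 3)) := by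
    intro a
    rw [hθ, hθ, ← pow_mul, ← pow_add]
    congr 2
    ring
  rw [h3, h4]
  obtain h | h : k % 3 = 1 ∨ k % 3 = 2 := by omega
  · left
    intro a
    rw [hθθ, hθ, h, mul_one, mul_one]
    exact ⟨rfl, rfl⟩
  · right
    intro a
    rw [hθθ, hθ, h, mul_comm e]
    refine ⟨rfl, ?_⟩
    rw [← hper e 1]
    congr 2
    rw [he]
    ring

/-- The exponent is symmetric in the two possibilities for `θ`, so it does not matter which of them
occurs. This is where the exponent defining `α̂` comes from. -/
theorem Coset.norm_eq_pow {J : P.Coset} (hJ : ¬ J.IsFixed) (a : J.K) :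
    J.theta.1 a * J.theta.1 (J.theta.1 a) = a ^ (P.q ^ (2 * J.d / 3) + P.q ^ (J.d / 3)) := by
  rcases theta_cases hJ with h | h <;> rw [(h a).2, (h a).1, pow_add]
  rw [mul_comm]

theorem Coset.one_lt_q : 1 < P.q := Fintype.one_lt_card

theorem Coset.d_pos (J : P.Coset) : 0 < J.d := by
  rw [← J.finrank_K]
  exact Module.finrank_pos

theorem Coset.orderOf_primitive {J : P.Coset} {z : J.Kˣ} (hz : ∀ u, u ∈ Subgroup.zpowers z) :
    orderOf z = P.q ^ J.d - 1 := by
  rw [orderOf_eq_card_of_forall_mem_zpowers hz, Nat.card_units, card_K]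

/-- A form of Hilbert 90 in a cyclic group. With `q^(d/3) = p + 1`, the order of `Kᵢˣ` is `p` times
the norm exponent `1 + (p+1) + (p+1)²`, so the elements of norm one are exactly the powers of `z^p`.
-/
theorem Coset.mem_calG_iff {J : P.Coset} (hJ : ¬ J.IsFixed) {z : J.Kˣ}
    (hz : ∀ u, u ∈ Subgroup.zpowers z) (α : J.Kˣ) :
    α ∈ J.calG z ↔ (α : J.K) * J.theta.1 α * J.theta.1 (J.theta.1 α) = 1 := by
  obtain ⟨e, he⟩ := three_dvd_d hJ
  have h3 : J.d / 3 = e := by omega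
  have h4 : 2 * J.d / 3 = 2 * e := by omega
  obtain ⟨p, hp⟩ : ∃ p, P.q ^ e = p + 1 := ⟨P.q ^ e - 1, by
    have := Nat.one_le_pow e P.q (Nat.zero_lt_of_lt one_lt_q)
    omega⟩
  have hppos : 0 < p := by
    have : 1 < P.q ^ e := Nat.one_lt_pow (by have := J.d_pos; omega) one_lt_q
    omega
  have hp2 : P.q ^ (2 * e) = (p + 1) ^ 2 := by rw [← hp, ← pow_mul, mul_comm]
  have hN : (α : J.K) * J.theta.1 α * J.theta.1 (J.theta.1 α) = 1 ↔
      α ^ (1 + ((p + 1) ^ 2 + (p + 1))) = 1 := by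
    rw [mul_assoc, norm_eq_pow hJ, h3, h4, hp, hp2, ← Units.val_inj, Units.val_pow_eq_pow_val,
      pow_add _ 1, pow_one, Units.val_one]
  have hord : (orderOf z : ℤ) = p * (1 + ((p + 1) ^ 2 + (p + 1))) := by
    rw [orderOf_primitive hz, he, mul_comm, pow_mul, hp]
    have : (p + 1) ^ 3 - 1 = p * (1 + ((p + 1) ^ 2 + (p + 1))) := by
      rw [Nat.sub_eq_iff_eq_add (Nat.one_le_pow _ _ (Nat.succ_pos p)), Nat.succ_eq_add_one]
      ring
    rw [this]
    push_cast
    ring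
  rw [hN, calG, h3, hp, Nat.add_sub_cancel]
  constructor
  · intro h
    obtain ⟨k, rfl⟩ := Subgroup.mem_zpowers_iff.1 h
    rw [← zpow_natCast, ← zpow_natCast, ← zpow_mul, ← zpow_mul, ← orderOf_dvd_iff_zpow_eq_one, hord]
    exact ⟨k, by push_cast; ring⟩
  · intro h
    obtain ⟨k, rfl⟩ := Subgroup.mem_zpowers_iff.1 (hz α)
    rw [← zpow_natCast, ← zpow_mul, ← orderOf_dvd_iff_zpow_eq_one, hord] at h
    push_cast at h
    obtain ⟨c, rfl⟩ := Int.dvd_of_mul_dvd_mul_right (by positivity) h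
    rw [Subgroup.mem_zpowers_iff]
    exact ⟨c, by rw [← zpow_natCast, ← zpow_mul]⟩

/-- `ω³ = 1`, while `ω ≠ 1` because its exponent is positive and smaller than the order of `z`. -/
theorem Coset.omega_root {J : P.Coset} {z : J.Kˣ} (hz : ∀ u, u ∈ Subgroup.zpowers z)
    (h : P.q ^ J.d % 3 = 1) : J.omega z ^ 2 + J.omega z + 1 = 0 := by
  have hd : 1 < P.q ^ J.d := Nat.one_lt_pow J.d_pos.ne' one_lt_q
  obtain ⟨n, hn⟩ : ∃ n, P.q ^ J.d - 1 = n * 3 := ⟨(P.q ^ J.d - 1) / 3, by omega⟩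
  have hw : J.omega z = ((z ^ n : J.Kˣ) : J.K) := by
    rw [omega, hn, Nat.mul_div_cancel _ three_pos, Units.val_pow_eq_pow_val]
  have h3 : (z ^ n) ^ 3 = 1 := by
    rw [← pow_mul, ← hn, ← orderOf_primitive hz, pow_orderOf_eq_one]
  have h1 : J.omega z ≠ 1 := by
    rw [hw, Ne, Units.val_eq_one]
    refine pow_ne_one_of_lt_orderOf (by omega) ?_
    rw [orderOf_primitive hz]
    omega
  have h3' : J.omega z ^ 3 = 1 := by rw [hw, ← Units.val_pow_eq_pow_val, h3, Units.val_one]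
  refine (mul_eq_zero.1 ?_).resolve_left (sub_ne_zero.2 h1)
  linear_combination h3'

theorem Coset.cast_card (J : P.Coset) : ((P.q ^ J.d : ℕ) : J.K) = 0 := by
  have := Fintype.ofFinite J.K
  rw [← J.card_K, Nat.card_eq_fintype_card]
  exact Nat.cast_card_eq_zero _

theorem Coset.three_eq_zero (J : P.Coset) (h : P.q % 3 = 0) : (3 : J.K) = 0 := by
  obtain ⟨p, hc, n, hp, hq⟩ := FiniteField.card' F
  have h3 : 3 ∣ p := Nat.prime_three.dvd_of_dvd_pow (n := n)
    (by rw [← hq]; exact Nat.dvd_of_mod_eq_zero h)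
  have h4 : (3 : F) = 0 := by
    rw [← (Nat.prime_dvd_prime_iff_eq Nat.prime_three hp).1 h3] at hc
    exact_mod_cast CharP.cast_eq_zero F 3
  rw [← map_ofNat (algebraMap F J.K) 3, h4, map_zero]

/-- A root satisfies `a³ = 1`, so `a = a^|K| = a²` and `a = 1`, giving `3 = 0` in `K`. But `|K| = 0`
in `K` and `|K| ≡ 2` modulo `3`, so `2 = 0` as well. -/
theorem Coset.quadratic_ne_zero (J : P.Coset) (h : P.q ^ J.d % 3 = 2) (a : J.K) :
    a ^ 2 + a + 1 ≠ 0 := by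
  intro ha
  have ha3 : a ^ 3 = 1 := by linear_combination (a - 1) * ha
  have ha0 : a ≠ 0 := by rintro rfl; simp at ha
  have hpow : a ^ (P.q ^ J.d) = a := (J.pow_eq_self_iff J.d).2 dvd_rfl a
  have ha1 : a = 1 := by
    rw [← Nat.div_add_mod (P.q ^ J.d) 3, pow_add, pow_mul, ha3, one_pow, one_mul, h,
      pow_two] at hpow
    simpa [ha0] using hpow
  have h3 : (3 : J.K) = 0 := by
    rw [ha1] at ha
    linear_combination ha
  have hc := J.cast_card
  rw [← Nat.div_add_mod (P.q ^ J.d) 3, h] at hc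
  push_cast at hc
  rw [h3, zero_mul, zero_add] at hc
  exact one_ne_zero (α := J.K) (by linear_combination h3 - hc)

end MetacyclicData

/-! ### Normal forms `xⁱyʲ` in the group. -/

namespace MetacyclicGroup

variable (m r : ℕ)

theorem x_pow : x m r ^ m = 1 := by
  have h := PresentedGroup.one_of_mem (rels := metacyclicRels m r) (x := FreeGroup.of 0 ^ m)
    (by simp [metacyclicRels])
  rwa [map_pow] at h

theorem y_pow : y m r ^ 3 = 1 := by
  have h := PresentedGroup.one_of_mem (rels := metacyclicRels m r) (x := FreeGroup.of 1 ^ 3)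
    (by simp [metacyclicRels])
  rwa [map_pow] at h

theorem y_mul_x : y m r * x m r = x m r ^ r * y m r := by
  have h := PresentedGroup.mk_eq_mk_of_mul_inv_mem (rels := metacyclicRels m r)
    (x := FreeGroup.of 1 * FreeGroup.of 0) (y := FreeGroup.of 0 ^ r * FreeGroup.of 1)
    (by simp [metacyclicRels])
  rwa [map_mul, map_mul, map_pow] at h

theorem y_pow_mul_x_pow (i j : ℕ) : y m r ^ j * x m r ^ i = x m r ^ (r ^ j * i) * y m r ^ j := by
  have h1 (i : ℕ) : y m r * x m r ^ i = x m r ^ (r * i) * y m r := by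
    have h : SemiconjBy (y m r) (x m r) (x m r ^ r) := y_mul_x m r
    have := h.pow_right i
    rwa [← pow_mul] at this
  induction j with
  | zero => simp
  | succ j ih => rw [pow_succ', mul_assoc, ih, ← mul_assoc, h1, mul_assoc, ← pow_succ', ← mul_assoc,
      ← pow_succ']

variable {m r} in
theorem induction_gens {p : MetacyclicGroup m r → Prop} (hx : p (x m r)) (hy : p (y m r))
    (one : p 1) (mul : ∀ a b, p a → p b → p (a * b)) (inv : ∀ a, p a → p a⁻¹)
    (g : MetacyclicGroup m r) : p g := by
  have hg : g ∈ Subgroup.closure (Set.range (PresentedGroup.of (rels := metacyclicRels m r))) := by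
    rw [PresentedGroup.closure_range_of]
    trivial
  induction hg using Subgroup.closure_induction with
  | mem a ha =>
    obtain ⟨i, rfl⟩ := ha
    fin_cases i
    · exact hx
    · exact hy
  | one => exact one
  | mul a b _ _ ha hb => exact mul a b ha hb
  | inv a _ ha => exact inv a ha

variable {m r} in
theorem exists_eq_pow_mul_pow (hm : m ≠ 0) (g : MetacyclicGroup m r) :
    ∃ i < m, ∃ j < 3, g = x m r ^ i * y m r ^ j := by
  have hmul (i j k l : ℕ) : x m r ^ i * y m r ^ j * (x m r ^ k * y m r ^ l) =
      x m r ^ (i + r ^ j * k) * y m r ^ (j + l) := by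
    rw [mul_assoc, ← mul_assoc (y m r ^ j), y_pow_mul_x_pow, mul_assoc, ← mul_assoc, ← pow_add,
      ← pow_add]
  suffices h : ∃ i j, g = x m r ^ i * y m r ^ j by
    obtain ⟨i, j, rfl⟩ := h
    refine ⟨i % m, Nat.mod_lt _ (Nat.pos_of_ne_zero hm), j % 3, Nat.mod_lt _ three_pos, ?_⟩
    rw [← pow_eq_pow_mod _ (x_pow m r), ← pow_eq_pow_mod _ (y_pow m r)]
  induction g using induction_gens with
  | hx => exact ⟨1, 0, by simp⟩
  | hy => exact ⟨0, 1, by simp⟩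
  | one => exact ⟨0, 0, by simp⟩
  | mul a b ha hb =>
    obtain ⟨i, j, rfl⟩ := ha
    obtain ⟨k, l, rfl⟩ := hb
    exact ⟨_, _, hmul i j k l⟩
  | inv a ha =>
    obtain ⟨i, j, rfl⟩ := ha
    -- The inverse is `y^(2j) x^((m-1)i)`, with the power of `x` then moved to the front.
    refine ⟨r ^ (2 * j) * ((m - 1) * i), 2 * j, ?_⟩
    rw [← y_pow_mul_x_pow, inv_eq_iff_mul_eq_one, mul_assoc, ← mul_assoc (y m r ^ j), ← pow_add,
      show j + 2 * j = 3 * j by ring, pow_mul, y_pow, one_pow, one_mul, ← pow_add,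
      show i + (m - 1) * i = m * i by
        obtain ⟨n, rfl⟩ := Nat.exists_eq_succ_of_ne_zero hm
        rw [Nat.succ_sub_one, Nat.succ_eq_add_one]; ring, pow_mul, x_pow, one_pow]

end MetacyclicGroup

/-! ### The involution `g ↦ g⁻¹` of a group algebra -/

namespace MonoidAlgebra

variable {F G : Type*} [Field F] [Group G]

/-- The linear extension of `g ↦ g⁻¹`. -/
noncomputable def invol (v : MonoidAlgebra F G) : MonoidAlgebra F G := mapDomain (fun g => g⁻¹) v

theorem invol_add (v w : MonoidAlgebra F G) : invol (v + w) = invol v + invol w :=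
  mapDomain_add _ _ _

theorem invol_zero : invol (0 : MonoidAlgebra F G) = 0 := mapDomain_zero _

theorem invol_single (g : G) (c : F) : invol (single g c) = single g⁻¹ c := mapDomain_single

theorem coeff_invol_inv (v : MonoidAlgebra F G) (g : G) : (invol v).coeff g⁻¹ = v.coeff g := by
  simpa [invol, mapDomain] using Finsupp.mapDomain_apply inv_injective v.coeff g

theorem invol_single_mul (g : G) (v : MonoidAlgebra F G) :
    invol (single g 1 * v) = invol v * single g⁻¹ 1 := by
  induction v using induction_linear with
  | zero => rw [mul_zero, invol_zero, zero_mul]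
  | add v w hv hw => rw [mul_add, invol_add, invol_add, add_mul, hv, hw]
  | single h c => simp [single_mul_single, invol_single]

end MonoidAlgebra

/-! ### The Euclidean dual as a left annihilator. -/

section Dual

variable {F : Type*} [Field F] {m r : ℕ}

open MonoidAlgebra

/-- `x ^ i * y ^ j` determines `i < m` and `j < 3`. -/
def NormalFormUnique (m r : ℕ) : Prop :=
  ∀ i < m, ∀ j < 3, ∀ k < m, ∀ l < 3,
    MetacyclicGroup.x m r ^ i * MetacyclicGroup.y m r ^ j =
      MetacyclicGroup.x m r ^ k * MetacyclicGroup.y m r ^ l → i = k ∧ j = l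

/-- The coefficient of `1` in `ξ η*` is the sum of `ξ(g)η(g)` over the group. Uniqueness of normal
forms ensures that the double sum meets each `g` only once. -/
theorem euclideanInner_eq_coeff_one (hm : m ≠ 0) (hu : NormalFormUnique m r)
    (ξ η : MonoidAlgebra F (MetacyclicGroup m r)) :
    euclideanInner ξ η = (ξ * invol η).coeff 1 := by
  induction ξ using induction_linear with
  | zero => simp [euclideanInner]
  | add v w hv hw =>
    rw [add_mul, MonoidAlgebra.coeff_add, Finsupp.add_apply, ← hv, ← hw]
    simp [euclideanInner, add_mul, Finset.sum_add_distrib]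
  | single g c =>
    have h1 : (single g c * invol η).coeff 1 = c * η.coeff g := by
      rw [coeff_single_mul_eq_mul_coeff g⁻¹ (fun _ _ => by rw [mul_eq_one_iff_eq_inv']),
        coeff_invol_inv]
    rw [h1]
    obtain ⟨i, hi, j, hj, rfl⟩ := MetacyclicGroup.exists_eq_pow_mul_pow hm g
    rw [euclideanInner, Finset.sum_eq_single i, Finset.sum_eq_single j]
    · simp
    · intro l hl hlj
      rw [coeff_single, Finsupp.single_eq_of_ne, zero_mul]
      exact fun h => hlj (hu _ hi _ (Finset.mem_range.1 hl) _ hi _ hj h).2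
    · exact fun h => absurd (Finset.mem_range.2 hj) h
    · intro k hk hki
      refine Finset.sum_eq_zero fun l hl => ?_
      rw [coeff_single, Finsupp.single_eq_of_ne, zero_mul]
      exact fun h => hki (hu _ (Finset.mem_range.1 hk) _ (Finset.mem_range.1 hl) _ hi _ hj h).1
    · exact fun h => absurd (Finset.mem_range.2 hi) h

/-- For `η ∈ I` also `gη ∈ I`, and the coefficient of `1` in `ξ(gη)* = ξη*g⁻¹` is the coefficient of
`g` in `ξη*`. -/
theorem mem_euclideanDual_iff (hm : m ≠ 0) (hu : NormalFormUnique m r)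
    (I : Ideal (MonoidAlgebra F (MetacyclicGroup m r)))
    (ξ : MonoidAlgebra F (MetacyclicGroup m r)) :
    ξ ∈ euclideanDual (I : Set (MonoidAlgebra F (MetacyclicGroup m r))) ↔
      ∀ η ∈ I, ξ * invol η = 0 := by
  constructor
  · intro h η hη
    ext g
    have h1 := h _ (I.mul_mem_left (single g 1) hη)
    rw [euclideanInner_eq_coeff_one hm hu, invol_single_mul, ← mul_assoc,
      coeff_mul_single_eq_coeff_mul g (fun _ _ => by simp [mul_inv_eq_one]), mul_one] at h1
    simpa using h1
  · intro h η hη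
    rw [euclideanInner_eq_coeff_one hm hu, h η hη]
    rfl

theorem euclideanDual_isLeftCode (hm : m ≠ 0) (hu : NormalFormUnique m r)
    (I : Ideal (MonoidAlgebra F (MetacyclicGroup m r))) :
    IsLeftCode (euclideanDual (I : Set (MonoidAlgebra F (MetacyclicGroup m r)))) := by
  refine ⟨{ carrier := {ξ | ∀ η ∈ I, ξ * invol η = 0}
            zero_mem' := fun η _ => zero_mul _
            add_mem' := fun ha hb η hη => by rw [add_mul, ha η hη, hb η hη, add_zero]
            smul_mem' := fun c a ha η hη => by
              rw [smul_eq_mul, mul_assoc, ha η hη, mul_zero] }, ?_⟩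
  ext ξ
  exact (mem_euclideanDual_iff hm hu I ξ).symm

end Dual

namespace MetacyclicData

variable {F L : Type*} [Field F] [Fintype F] [Field L] [Algebra F L] {P : MetacyclicData F L}

attribute [local instance] Coset.fact_irreducible_f

open SkewCyclic (const y constHom)

/-! ### The decomposition of the group algebra -/

theorem Coset.const_root_pow (J : P.Coset) (n : ℕ) :
    (const (AdjoinRoot.root J.f) : J.R) ^ n = const (AdjoinRoot.root J.f ^ n) :=
  (map_pow (constHom J.theta) _ n).symm

/-- The group homomorphism `x ↦ x`, `y ↦ y` to the units of `Rᵢ`. -/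
noncomputable def Coset.groupHom (J : P.Coset) : MetacyclicGroup P.m P.r →* J.Rˣ :=
  PresentedGroup.toGroup (f := ![
    Units.ofPowEqOne (const (AdjoinRoot.root J.f)) P.m
      (by rw [J.const_root_pow, J.root_pow_m, SkewCyclic.const_one]) (NeZero.ne P.m),
    Units.ofPowEqOne y 3 SkewCyclic.y_pow_three three_ne_zero]) <| by
    rintro g (rfl | rfl | rfl)
    · simp [Units.pow_ofPowEqOne]
    · simp [Units.pow_ofPowEqOne]
    · simp only [map_mul, map_inv, map_pow, FreeGroup.lift_apply_of, mul_inv_eq_one]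
      ext1
      simp [SkewCyclic.y_mul_const, J.theta_root, J.const_root_pow]

theorem Coset.groupHom_x (J : P.Coset) :
    (J.groupHom (MetacyclicGroup.x P.m P.r) : J.R) = const (AdjoinRoot.root J.f) :=
  congrArg Units.val (PresentedGroup.toGroup.of (x := 0) _)

theorem Coset.groupHom_y (J : P.Coset) : (J.groupHom (MetacyclicGroup.y P.m P.r) : J.R) = y :=
  congrArg Units.val (PresentedGroup.toGroup.of (x := 1) _)

theorem Coset.commute_const_of (J : P.Coset) (a : F) (c : J.R) :
    Commute (const (AdjoinRoot.of J.f a)) c := by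
  apply SkewCyclic.ext3 <;> simp [J.theta_of, mul_comm]

/-- The projection of the group algebra onto `Rᵢ`. -/
noncomputable def Coset.toR (J : P.Coset) : P.GroupAlg →+* J.R :=
  MonoidAlgebra.liftNCRingHom ((constHom J.theta).comp (AdjoinRoot.of J.f))
    ((Units.coeHom J.R).comp J.groupHom) fun a _ => J.commute_const_of a _

theorem Coset.toR_single (J : P.Coset) (g : MetacyclicGroup P.m P.r) (a : F) :
    J.toR (MonoidAlgebra.single g a) = const (AdjoinRoot.of J.f a) * (J.groupHom g : J.R) :=
  MonoidAlgebra.liftNCRingHom_single ..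

theorem Coset.toR_of (J : P.Coset) (g : MetacyclicGroup P.m P.r) :
    J.toR (MonoidAlgebra.of F _ g) = J.groupHom g := by
  rw [MonoidAlgebra.of_apply, toR_single, map_one, SkewCyclic.const_one, one_mul]

theorem Coset.toR_algY (J : P.Coset) : J.toR P.algY = y := by
  rw [algY, toR_of, groupHom_y]

theorem Coset.toR_evalX (J : P.Coset) (p : F[X]) :
    J.toR (P.evalX p) = const (AdjoinRoot.mk J.f p) := by
  have h : J.toR.comp (P.evalX : F[X] →+* P.GroupAlg) =
      (constHom J.theta).comp (AdjoinRoot.mk J.f) := by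
    refine Polynomial.ringHom_ext (fun a => ?_) ?_
    · simp [evalX, MonoidAlgebra.coe_algebraMap, toR_single]
    · simp [evalX, toR_of, groupHom_x, -MonoidAlgebra.of_apply]
  exact DFunLike.congr_fun h p

theorem Coset.toR_sum (J : P.Coset) (a : Fin 3 → F[X]) :
    J.toR (∑ j : Fin 3, P.evalX (a j) * P.algY ^ (j : ℕ)) =
      ⟨fun j => AdjoinRoot.mk J.f (a j)⟩ := by
  simp only [Fin.sum_univ_three, map_add, map_mul, map_pow, toR_evalX, toR_algY]
  rw [SkewCyclic.eq_const_add (⟨fun j => AdjoinRoot.mk J.f (a j)⟩ : J.R)]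
  simp

theorem exists_eq_sum (v : P.GroupAlg) :
    ∃ a : Fin 3 → F[X], v = ∑ j : Fin 3, P.evalX (a j) * P.algY ^ (j : ℕ) := by
  induction v using MonoidAlgebra.induction_linear with
  | zero => exact ⟨0, by simp⟩
  | add v w hv hw =>
    obtain ⟨a, rfl⟩ := hv
    obtain ⟨b, rfl⟩ := hw
    exact ⟨a + b, by simp [add_mul, Finset.sum_add_distrib]⟩
  | single g c =>
    obtain ⟨i, -, j, hj, rfl⟩ := MetacyclicGroup.exists_eq_pow_mul_pow (NeZero.ne P.m) g
    refine ⟨Pi.single ⟨j, hj⟩ (C c * X ^ i), ?_⟩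
    rw [Finset.sum_eq_single ⟨j, hj⟩]
    · simp [evalX, algY, MonoidAlgebra.coe_algebraMap, MonoidAlgebra.single_pow,
        MonoidAlgebra.single_mul_single]
    · intro k _ hk
      rw [Pi.single_eq_of_ne hk, map_zero, zero_mul]
    · simp

/-- The coset of `j`. -/
noncomputable def cosetOf (P : MetacyclicData F L) (j : ZMod P.m) : P.Coset :=
  ⟨P.cyclotomicCoset j, j, rfl⟩

theorem mem_cosetOf (j : ZMod P.m) : j ∈ (P.cosetOf j).1 :=
  mem_cyclotomicCoset.2 ⟨0, by simp⟩

/-- Each `m`-th root of unity `ζ^i` is a root of the `f` of its own coset, and `X^m - 1` has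
distinct roots. -/
theorem X_pow_sub_one_dvd {p : F[X]} (h : ∀ J : P.Coset, J.f ∣ p) : X ^ P.m - 1 ∣ p := by
  rw [← Polynomial.map_dvd_map' (algebraMap F L)]
  simp only [Polynomial.map_sub, Polynomial.map_pow, map_X, Polynomial.map_one]
  rw [X_pow_sub_one_eq_prod (NeZero.pos P.m) P.isPrimitiveRoot]
  refine Finset.prod_dvd_of_coprime ?_ ?_
  · exact fun a _ b _ hab => isCoprime_X_sub_C_of_isUnit_sub (IsUnit.mk0 _ (sub_ne_zero.2 hab))
  · intro a ha
    rw [mem_nthRootsFinset (NeZero.pos P.m)] at ha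
    obtain ⟨i, hi, rfl⟩ := P.isPrimitiveRoot.eq_pow_of_pow_eq_one ha
    have h1 := (P.cosetOf (i : ZMod P.m)).aeval_f (mem_cosetOf _)
    rw [ZMod.val_natCast_of_lt hi] at h1
    rw [dvd_iff_isRoot, IsRoot.def, eval_map_algebraMap]
    exact aeval_eq_zero_of_dvd_aeval_eq_zero (h _) h1

theorem evalX_eq_zero_of_dvd {p : F[X]} (h : X ^ P.m - 1 ∣ p) : P.evalX p = 0 := by
  obtain ⟨c, rfl⟩ := h
  have : P.evalX (X ^ P.m - 1) = 0 := by
    rw [map_sub, map_pow, map_one, evalX, aeval_X, ← map_pow, MetacyclicGroup.x_pow, map_one,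
      sub_self]
  rw [map_mul, this, zero_mul]

/-- The injective half of the Chinese remainder decomposition; equalities in the group algebra can
be checked in each `Rᵢ`. -/
theorem eq_of_toR_eq {v w : P.GroupAlg} (h : ∀ J : P.Coset, J.toR v = J.toR w) : v = w := by
  rw [← sub_eq_zero]
  obtain ⟨a, ha⟩ := exists_eq_sum (v - w)
  rw [ha]
  refine Finset.sum_eq_zero fun j _ => ?_
  rw [evalX_eq_zero_of_dvd, zero_mul]
  refine X_pow_sub_one_dvd fun J => ?_
  have h1 : J.toR (v - w) = 0 := by rw [map_sub, h, sub_self]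
  rw [ha, J.toR_sum] at h1
  rw [← AdjoinRoot.mk_eq_zero]
  exact congrArg (fun c => c.coeff j) h1

theorem Coset.aeval_f_eq_zero_iff (J : P.Coset) (j : ZMod P.m) :
    aeval (P.ζ ^ j.val) J.f = 0 ↔ j ∈ J.1 := by
  refine ⟨fun h => ?_, J.aeval_f⟩
  rw [← eval_map_algebraMap, J.map_f, eval_prod] at h
  obtain ⟨i, hi, h⟩ := Finset.prod_eq_zero_iff.1 h
  rw [eval_sub, eval_X, eval_C, sub_eq_zero] at h
  rwa [ZMod.val_injective _ (P.isPrimitiveRoot.pow_inj (ZMod.val_lt j) (ZMod.val_lt i) h)]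

/-- Both polynomials are the minimal polynomial of `ζ^j`, and a coset is recovered from the roots of
its polynomial. -/
theorem Coset.eq_of_mem {J J' : P.Coset} {j : ZMod P.m} (h : j ∈ J.1) (h' : j ∈ J'.1) :
    J = J' := by
  have hf : J.f = J'.f :=
    (minpoly.eq_of_irreducible_of_monic J.irreducible_f (J.aeval_f h) J.monic_f).trans
      (minpoly.eq_of_irreducible_of_monic J'.irreducible_f (J'.aeval_f h') J'.monic_f).symm
  refine Subtype.ext (Finset.ext fun i => ?_)
  rw [← J.aeval_f_eq_zero_iff, hf, J'.aeval_f_eq_zero_iff]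

theorem Coset.cof_mul_f (J : P.Coset) : J.cof * J.f = X ^ P.m - 1 := by
  rw [Coset.cof, mul_comm]
  exact EuclideanDomain.mul_div_cancel' J.monic_f.ne_zero J.f_dvd_X_pow_sub_one

theorem Coset.mk_idem (J : P.Coset) : AdjoinRoot.mk J.f J.idem = 1 := by
  obtain ⟨v, hv⟩ := Classical.choose_spec J.exists_bezout
  have h := congrArg (AdjoinRoot.mk J.f) hv
  rwa [map_add, map_mul _ v, AdjoinRoot.mk_self, mul_zero, add_zero, map_one] at h

/-- At `ζ^j` with `j` outside `J`, the product `Fᵢfᵢ = X^m - 1` vanishes while `fᵢ` does not, so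
`Fᵢ` does. -/
theorem Coset.mk_idem_of_ne {J J' : P.Coset} (h : J' ≠ J) : AdjoinRoot.mk J'.f J.idem = 0 := by
  rw [AdjoinRoot.mk_eq_zero]
  refine J'.f_dvd fun j hj => ?_
  have h1 := congrArg (aeval (P.ζ ^ j.val)) J.cof_mul_f
  rw [map_mul, aeval_eq_zero_of_dvd_aeval_eq_zero J'.f_dvd_X_pow_sub_one (J'.aeval_f hj)] at h1
  rw [idem, map_mul, (mul_eq_zero.1 h1).resolve_right, mul_zero]
  rw [J.aeval_f_eq_zero_iff]
  exact fun hj' => h (Coset.eq_of_mem hj hj')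

theorem Coset.toR_concat_elem (J : P.Coset) (a : Fin 3 → F[X]) :
    J.toR (∑ j : Fin 3, P.evalX (J.idem * a j) * P.algY ^ (j : ℕ)) =
      ⟨fun j => AdjoinRoot.mk J.f (a j)⟩ := by
  rw [toR_sum]
  simp only [map_mul, mk_idem, one_mul]

theorem Coset.toR_concat_elem_of_ne {J J' : P.Coset} (h : J' ≠ J) (a : Fin 3 → F[X]) :
    J'.toR (∑ j : Fin 3, P.evalX (J.idem * a j) * P.algY ^ (j : ℕ)) = 0 := by
  rw [toR_sum]
  simp only [map_mul, mk_idem_of_ne h, zero_mul]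
  rfl

/-- Multiplication by `εᵢ` is the inclusion of the `i`-th factor, because `εᵢ` is `1` in `Kᵢ` and
`0` in the others. -/
theorem Coset.mem_concat_iff (J : P.Coset) (I : Ideal J.R) (v : P.GroupAlg) :
    v ∈ J.concat I ↔ J.toR v ∈ I ∧ ∀ J' : P.Coset, J' ≠ J → J'.toR v = 0 := by
  constructor
  · rintro ⟨a, ha, rfl⟩
    rw [toR_concat_elem]
    exact ⟨ha, fun J' h => toR_concat_elem_of_ne h a⟩
  · rintro ⟨h1, h2⟩
    choose a ha using fun j => AdjoinRoot.mk_surjective (J.toR v |>.coeff j)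
    have hv : (⟨fun j => AdjoinRoot.mk J.f (a j)⟩ : J.R) = J.toR v :=
      SkewCyclic.ext (funext ha)
    refine ⟨a, hv ▸ h1, eq_of_toR_eq fun J' => ?_⟩
    by_cases h : J' = J
    · subst h
      rw [toR_concat_elem, hv]
    · rw [toR_concat_elem_of_ne h, h2 _ h]

theorem Coset.exists_toR_eq (J : P.Coset) (c : J.R) :
    ∃ v : P.GroupAlg, J.toR v = c ∧ ∀ J' : P.Coset, J' ≠ J → J'.toR v = 0 := by
  choose a ha using fun j => AdjoinRoot.mk_surjective (c.coeff j)
  refine ⟨_, (J.toR_concat_elem a).trans ?_, fun J' h => toR_concat_elem_of_ne h a⟩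
  exact SkewCyclic.ext (funext ha)

instance Coset.finite : Finite P.Coset :=
  inferInstanceAs (Finite {J : Finset (ZMod P.m) // ∃ s, J = P.cyclotomicCoset s})

theorem mem_iSup_concat_iff (C : ∀ J : P.Coset, Ideal J.R) (v : P.GroupAlg) :
    v ∈ (⨆ J : P.Coset, J.concat (C J)) ↔ ∀ J : P.Coset, J.toR v ∈ C J := by
  classical
  constructor
  · intro h J
    refine Submodule.iSup_induction _ (motive := fun v => J.toR v ∈ C J) h ?_ ?_ ?_
    · intro J' w hw
      rw [Coset.mem_concat_iff] at hw
      by_cases hJ : J = J'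
      · subst hJ
        exact hw.1
      · rw [hw.2 J hJ]
        exact zero_mem _
    · rw [map_zero]
      exact zero_mem _
    · intro a b ha hb
      rw [map_add]
      exact add_mem ha hb
  · intro h
    have := Fintype.ofFinite P.Coset
    choose w hw hw' using fun J : P.Coset => J.exists_toR_eq (J.toR v)
    have hv : v = ∑ J, w J := by
      refine eq_of_toR_eq fun J => ?_
      rw [map_sum, Finset.sum_eq_single J, hw]
      · exact fun J' _ hJ' => hw' J' J hJ'.symm
      · exact fun h => absurd (Finset.mem_univ J) h
    rw [hv]
    refine sum_mem fun J _ => Submodule.mem_iSup_of_mem J ?_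
    rw [Coset.mem_concat_iff, hw]
    exact ⟨h J, hw' J⟩

theorem iSupIndep_concat (C : ∀ J : P.Coset, Ideal J.R) :
    iSupIndep fun J : P.Coset => J.concat (C J) := by
  intro J
  rw [Submodule.disjoint_def]
  intro v hv hv'
  rw [Coset.mem_concat_iff] at hv
  refine eq_of_toR_eq fun J' => ?_
  rw [map_zero]
  by_cases h : J' = J
  · subst h
    refine Submodule.iSup_induction _ (motive := fun v => J'.toR v = 0) hv' ?_ (map_zero _) ?_
    · intro K w hw
      refine Submodule.iSup_induction _ (motive := fun v => J'.toR v = 0) hw ?_ (map_zero _) ?_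
      · intro hK w hw
        exact ((Coset.mem_concat_iff _ _ _).1 hw).2 J' hK.symm
      · intro a b ha hb
        rw [map_add, ha, hb, add_zero]
    · intro a b ha hb
      rw [map_add, ha, hb, add_zero]
  · exact hv.2 J' h

theorem isConcatSum_iff (S : Set P.GroupAlg) (C : ∀ J : P.Coset, Ideal J.R) :
    IsConcatSum S C ↔ ∀ v, v ∈ S ↔ ∀ J : P.Coset, J.toR v ∈ C J := by
  rw [IsConcatSum, and_iff_right (iSupIndep_concat C), Set.ext_iff]
  simp only [SetLike.mem_coe, mem_iSup_concat_iff]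
  exact forall_congr' fun v => Iff.comm

/-! ### Duality -/

theorem Coset.neg_neg (J : P.Coset) : J.neg.neg = J := by
  refine Subtype.ext (Finset.ext fun a => ?_)
  simp [neg]

theorem Coset.neg_injective : Function.Injective (Coset.neg (P := P)) := fun J J' h => by
  rw [← J.neg_neg, h, J'.neg_neg]

/-- Because `star` is anti-multiplicative, it suffices to treat the generators, where it inverts `x`
through `μ` and `y` by definition. -/
theorem Coset.star_groupHom (J : P.Coset) (g : MetacyclicGroup P.m P.r) :
    SkewCyclic.star J.neg.theta J.mu (J.groupHom g : J.R) = (J.neg.groupHom g⁻¹ : J.neg.Rˣ) := by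
  suffices h : SkewCyclic.star J.neg.theta J.mu (J.groupHom g : J.R) * J.neg.groupHom g = 1 by
    rw [map_inv]
    exact Units.eq_inv_of_mul_eq_one_right h
  have hmul := SkewCyclic.star_mul J.mu_theta
  induction g using MetacyclicGroup.induction_gens with
  | hx =>
    rw [groupHom_x, groupHom_x]
    have h : AdjoinRoot.root J.neg.f ^ (P.m - 1) * AdjoinRoot.root J.neg.f = 1 := by
      rw [← pow_succ, Nat.sub_add_cancel (NeZero.pos P.m), J.neg.root_pow_m]
    apply SkewCyclic.ext3 <;> simp [J.mu_root, h]
  | hy =>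
    rw [groupHom_y, groupHom_y]
    apply SkewCyclic.ext3 <;> simp
  | one => rw [map_one, map_one, Units.val_one, SkewCyclic.star_one, Units.val_one, one_mul]
  | mul a b ha hb =>
    rw [map_mul, map_mul, Units.val_mul, Units.val_mul, hmul, mul_assoc,
      ← mul_assoc _ (J.neg.groupHom a : J.neg.R), ha, one_mul, hb]
  | inv a ha =>
    have h := Units.eq_inv_of_mul_eq_one_right ha
    rw [map_inv, map_inv, ← h, ← hmul, Units.mul_inv, SkewCyclic.star_one]

theorem Coset.toR_neg_invol (J : P.Coset) (v : P.GroupAlg) :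
    J.neg.toR (MonoidAlgebra.invol v) = SkewCyclic.star J.neg.theta J.mu (J.toR v) := by
  induction v using MonoidAlgebra.induction_linear with
  | zero => rw [MonoidAlgebra.invol_zero, map_zero, map_zero, SkewCyclic.star_zero]
  | add v w hv hw => rw [MonoidAlgebra.invol_add, map_add, map_add, SkewCyclic.star_add, hv, hw]
  | single g c =>
    rw [MonoidAlgebra.invol_single, toR_single, toR_single, SkewCyclic.star_mul J.mu_theta,
      star_groupHom, (J.neg.commute_const_of c _).eq]
    congr 1
    apply SkewCyclic.ext3 <;> simp [J.mu_of]

/-- The forms are already distinct in `Rᵢ` for the coset of `1`: the position of the nonzero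
coefficient shows `j`, and its value shows `i`, as `ζ` has order `m`. -/
theorem normalFormUnique (P : MetacyclicData F L) : NormalFormUnique P.m P.r := by
  have h3 := P.three_le
  intro i hi j hj k hk l hl h
  set J := P.cosetOf 1 with hJ
  have h1 := congrArg (fun g => (J.groupHom g : J.R)) h
  simp only [map_mul, map_pow, Units.val_mul, Units.val_pow_eq_pow_val, Coset.groupHom_x,
    Coset.groupHom_y, Coset.const_root_pow] at h1
  have hroot (n : ℕ) : AdjoinRoot.root J.f ^ n ≠ 0 :=
    pow_ne_zero n fun h0 => by
      have := J.root_pow_m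
      rw [h0, zero_pow (NeZero.ne P.m)] at this
      exact zero_ne_one this
  have hcoeff (t n : ℕ) (ht : t < 3) (s : Fin 3) :
      (const (AdjoinRoot.root J.f ^ n) * (y : J.R) ^ t).coeff s =
        if s.val = t then AdjoinRoot.root J.f ^ n else 0 := by
    interval_cases t <;> fin_cases s <;> simp [pow_two]
  have h2 := congrArg (fun c => c.coeff ⟨j, hj⟩) h1
  simp only [hcoeff _ _ hj, hcoeff _ _ hl, if_true] at h2
  have hjl : j = l := by
    by_contra hne
    rw [if_neg hne] at h2
    exact hroot _ h2
  refine ⟨?_, hjl⟩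
  rw [if_pos hjl, ← sub_eq_zero] at h2
  have hmk : AdjoinRoot.root J.f ^ i - AdjoinRoot.root J.f ^ k =
    AdjoinRoot.mk J.f (X ^ i - X ^ k) := by simp
  rw [hmk, AdjoinRoot.mk_eq_zero] at h2
  have h4 := aeval_eq_zero_of_dvd_aeval_eq_zero h2 (J.aeval_f (mem_cosetOf 1))
  have : Fact (1 < P.m) := ⟨by omega⟩
  rw [ZMod.val_one, pow_one, map_sub, map_pow, map_pow, aeval_X, sub_eq_zero] at h4
  exact P.isPrimitiveRoot.pow_inj hi hk h4

/-- The dual code, component by component: the component at `-J` is the left annihilator of the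
image of `C J` under `star`. -/
theorem exists_dual (𝒞 : Set P.GroupAlg) (h𝒞 : IsLeftCode 𝒞) (C : ∀ J : P.Coset, Ideal J.R)
    (hC : IsConcatSum 𝒞 C) :
    IsLeftCode (euclideanDual 𝒞) ∧ ∃ D : ∀ J : P.Coset, Ideal J.R,
      IsConcatSum (euclideanDual 𝒞) D ∧ ∀ (J : P.Coset) (d : J.neg.R),
        d ∈ D J.neg ↔ ∀ c ∈ C J, d * SkewCyclic.star J.neg.theta J.mu c = 0 := by
  obtain ⟨I, rfl⟩ := h𝒞
  have hu := normalFormUnique P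
  have hcode := euclideanDual_isLeftCode (F := F) (NeZero.ne P.m) hu I
  refine ⟨hcode, ?_⟩
  obtain ⟨I', hI'⟩ := hcode
  rw [isConcatSum_iff] at hC
  have hmem : ∀ ξ, ξ ∈ I' ↔ ∀ (J : P.Coset), ∀ c ∈ C J,
      J.neg.toR ξ * SkewCyclic.star J.neg.theta J.mu c = 0 := by
    intro ξ
    rw [← SetLike.mem_coe, hI', mem_euclideanDual_iff (NeZero.ne P.m) hu]
    constructor
    · intro h J c hc
      -- A codeword with component `c` at `J` and zero elsewhere isolates the condition at `J`.
      obtain ⟨v, rfl, hv⟩ := J.exists_toR_eq c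
      have hvI : v ∈ I := by
        refine (hC v).2 fun J' => ?_
        by_cases hJ : J' = J
        · subst hJ
          exact hc
        · rw [hv _ hJ]
          exact zero_mem _
      rw [← J.toR_neg_invol, ← map_mul, h v hvI, map_zero]
    · intro h η hη
      refine eq_of_toR_eq fun K => ?_
      obtain ⟨J, rfl⟩ : ∃ J : P.Coset, K = J.neg := ⟨K.neg, K.neg_neg.symm⟩
      rw [map_mul, J.toR_neg_invol, h J _ ((hC η).1 hη J), map_zero]
  have hsurj (J : P.Coset) : Function.Surjective J.toR := fun c =>
    (J.exists_toR_eq c).imp fun v hv => hv.1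
  have hD (J : P.Coset) (d : J.R) : d ∈ I'.map J.toR ↔ ∃ ξ ∈ I', J.toR ξ = d :=
    Ideal.mem_map_iff_of_surjective _ (hsurj J)
  -- `D` consists of the projections of the dual. Since membership in the dual is a separate
  -- condition on each component, the dual is the full sum of these projections.
  refine ⟨fun J => I'.map J.toR, ?_, ?_⟩
  · rw [isConcatSum_iff, ← hI']
    intro v
    refine ⟨fun hv J => Ideal.mem_map_of_mem _ hv, fun hv => ?_⟩
    rw [SetLike.mem_coe, hmem]
    intro J c hc
    obtain ⟨ξ, hξ, h⟩ := (hD _ _).1 (hv J.neg)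
    rw [← h]
    exact (hmem ξ).1 hξ J c hc
  · intro J d
    rw [hD]
    constructor
    · rintro ⟨ξ, hξ, rfl⟩
      exact (hmem ξ).1 hξ J
    · intro h
      obtain ⟨ξ, rfl, hξ⟩ := J.neg.exists_toR_eq d
      refine ⟨ξ, (hmem ξ).2 fun J' c hc => ?_, rfl⟩
      by_cases hJ : J' = J
      · subst hJ
        exact h c hc
      · rw [hξ _ fun h => hJ (Coset.neg_injective h), zero_mul]

end MetacyclicData

/-! ### Dual components in the fixed and non-fixed cases. -/

namespace MetacyclicData

variable {F L : Type*} [Field F] [Fintype F] [Field L] [Algebra F L] {P : MetacyclicData F L}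

attribute [local instance] Coset.fact_irreducible_f

open SkewCyclic (const y)

theorem Coset.followsTable_of {J : P.Coset} {T : Set (J.R × J.neg.R)} {C : Ideal J.R}
    {D : Ideal J.neg.R}
    (hD : ∀ d, d ∈ D ↔ ∀ c ∈ C, d * SkewCyclic.star J.neg.theta J.mu c = 0)
    (hT : ∀ p ∈ T, SkewCyclic.IsDualPair J.neg.theta J.mu p)
    (hC : ∃ p ∈ T, C = Ideal.span {p.1}) : J.FollowsTable T C D :=
  ⟨hC, fun p hp h => SkewCyclic.eq_span_of_isDualPair J.mu_theta hD (hT p hp) h⟩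

section Fixed

variable {J : P.Coset} (hJ : J.IsFixed) {C : Ideal J.R} {D : Ideal J.neg.R}
  (hD : ∀ d, d ∈ D ↔ ∀ c ∈ C, d * SkewCyclic.star J.neg.theta J.mu c = 0)

include hJ hD

theorem Coset.followsTable_zero (hq : P.q % 3 = 0) : J.FollowsTable J.tableZero C D := by
  have hθ := J.theta_eq_self_iff.2 hJ
  have hθ' := J.neg.theta_eq_self_iff.2 (isFixed_neg.2 hJ)
  refine followsTable_of hD (SkewCyclic.isDualPair_cases_zero J.mu_theta hθ'
    (J.neg.three_eq_zero hq)) ?_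
  obtain ⟨k, hk, h⟩ := SkewCyclic.ideal_cases_of_three_eq_zero hθ (J.three_eq_zero hq) C
  simp only [tableZero, Set.mem_insert_iff, Set.mem_singleton_iff]
  interval_cases k
  · exact ⟨_, Or.inl rfl, by rw [h, pow_zero]⟩
  · exact ⟨_, Or.inr (Or.inl rfl), by rw [h, pow_one]⟩
  · exact ⟨_, Or.inr (Or.inr (Or.inl rfl)), h⟩
  · exact ⟨_, Or.inr (Or.inr (Or.inr rfl)), h⟩

theorem Coset.followsTable_two (hq : P.q ^ J.d % 3 = 2) : J.FollowsTable J.tableTwo C D := by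
  have hθ := J.theta_eq_self_iff.2 hJ
  have hθ' := J.neg.theta_eq_self_iff.2 (isFixed_neg.2 hJ)
  refine followsTable_of hD (SkewCyclic.isDualPair_cases_two hθ') ?_
  have h := SkewCyclic.ideal_cases_of_prime_quadratic hθ (J.quadratic_ne_zero hq) C
  simpa only [tableTwo, Set.mem_insert_iff, Set.mem_singleton_iff, exists_eq_or_imp,
    exists_eq_left] using h

theorem Coset.followsTable_one {z : J.Kˣ} (hz : ∀ u, u ∈ Subgroup.zpowers z)
    (hq : P.q ^ J.d % 3 = 1) :
    J.FollowsTable (J.tableOne (J.omega z) (J.mu (J.omega z))) C D := by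
  have hθ := J.theta_eq_self_iff.2 hJ
  have hθ' := J.neg.theta_eq_self_iff.2 (isFixed_neg.2 hJ)
  have hw := omega_root hz hq
  refine followsTable_of hD (SkewCyclic.isDualPair_cases_one J.mu_theta hθ' hw) ?_
  have h := SkewCyclic.ideal_cases_of_root hθ hw C
  simpa only [tableOne, Set.mem_insert_iff, Set.mem_singleton_iff, exists_eq_or_imp,
    exists_eq_left] using h

end Fixed

section NotFixed

variable {J : P.Coset} (hJ : ¬ J.IsFixed)

theorem Coset.coe_thetaU (J : P.Coset) (α : J.Kˣ) : (J.thetaU α : J.K) = J.theta.1 α := rfl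

/-- The image of `α` under `μ`. -/
noncomputable def Coset.muU (J : P.Coset) (α : J.Kˣ) : J.neg.Kˣ := Units.map J.mu.toMonoidHom α

theorem Coset.coe_muU (J : P.Coset) (α : J.Kˣ) : (J.muU α : J.neg.K) = J.mu α := rfl

theorem Coset.norm_mu {α : J.K} (hα : α * J.theta.1 α * J.theta.1 (J.theta.1 α) = 1) :
    J.mu α * J.neg.theta.1 (J.mu α) * J.neg.theta.1 (J.neg.theta.1 (J.mu α)) = 1 := by
  simpa only [map_mul, map_one, mu_theta] using congrArg J.mu hα

/-- `μ(α)` has norm one, and the exponent in `α̂` computes the product of its two other conjugates,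
which is its inverse. -/
theorem Coset.hat_eq_inv {α : J.Kˣ}
    (hα : (α : J.K) * J.theta.1 α * J.theta.1 (J.theta.1 α) = 1) (hJ : ¬ J.IsFixed) :
    J.hat α = (J.muU α)⁻¹ := by
  refine (inv_eq_of_mul_eq_one_right (Units.ext ?_)).symm
  rw [Units.val_mul, Coset.hat, Units.val_pow_eq_pow_val]
  have h := norm_mu hα
  rw [mul_assoc, norm_eq_pow (fun h => hJ (isFixed_neg.1 h)), d_neg] at h
  exact h

theorem Coset.norm_theta {β : J.K} (h : β * J.theta.1 β * J.theta.1 (J.theta.1 β) = 1) :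
    J.theta.1 β * J.theta.1 (J.theta.1 β) * J.theta.1 (J.theta.1 (J.theta.1 β)) = 1 := by
  simpa only [map_mul, map_one] using congrArg J.theta.1 h

theorem Coset.norm_hat {α : J.Kˣ}
    (hα : (α : J.K) * J.theta.1 α * J.theta.1 (J.theta.1 α) = 1) (hJ : ¬ J.IsFixed) :
    (J.hat α : J.neg.K) * J.neg.theta.1 (J.hat α) * J.neg.theta.1 (J.neg.theta.1 (J.hat α)) =
      1 := by
  have h : J.muU α * J.neg.thetaU (J.muU α) * J.neg.thetaU (J.neg.thetaU (J.muU α)) = 1 :=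
    Units.ext (norm_mu hα)
  have h' := congrArg Inv.inv h
  rw [hat_eq_inv hα hJ, ← coe_thetaU, ← coe_thetaU, ← Units.val_mul, ← Units.val_mul,
    Units.val_eq_one]
  simpa only [mul_inv, map_inv, inv_one] using h'

variable {C : Ideal J.R} {D : Ideal J.neg.R}
  (hD : ∀ d, d ∈ D ↔ ∀ c ∈ C, d * SkewCyclic.star J.neg.theta J.mu c = 0)

include hJ hD

theorem Coset.dual_codeOne {α : J.Kˣ}
    (hα : (α : J.K) * J.theta.1 α * J.theta.1 (J.theta.1 α) = 1) (hC : C = J.codeOne α) :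
    D = J.neg.codeTwo (J.neg.thetaU (J.hat α)) := by
  ext d
  rw [SkewCyclic.mem_iff_of_eq_span J.mu_theta hD hC]
  have h1 : J.mu α * J.mu ((α⁻¹ : J.Kˣ) : J.K) = 1 := by
    rw [← map_mul, Units.mul_inv, map_one]
  have h2 : J.neg.theta.1 (J.mu α) * (J.neg.thetaU (J.hat α) : J.neg.K) = 1 := by
    rw [hat_eq_inv hα hJ, coe_thetaU, ← map_mul, ← coe_muU, Units.mul_inv, map_one]
  rw [codeTwo, ← SkewCyclic.mul_quadratic_eq_zero_iff (norm_mu hα) h1 h2]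
  -- In the `y²`-coefficient, `θ²` from `star` meets `θ²` from the generator and `θ⁴ = θ`.
  suffices h : SkewCyclic.star J.neg.theta J.mu (const ((α⁻¹ : J.Kˣ) : J.K) +
      const (J.thetaU (J.thetaU α) : J.K) * y + y ^ 2 : J.R) =
      const (J.mu ((α⁻¹ : J.Kˣ) : J.K)) + y + const (J.neg.theta.1 (J.mu α)) * y ^ 2 by rw [h]
  rw [pow_two, pow_two, coe_thetaU, coe_thetaU]
  apply SkewCyclic.ext3 <;> simp [mu_theta, SkewCyclic.theta_theta_theta]

theorem Coset.dual_codeTwo {α : J.Kˣ}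
    (hα : (α : J.K) * J.theta.1 α * J.theta.1 (J.theta.1 α) = 1) (hC : C = J.codeTwo α) :
    D = J.neg.codeOne (J.neg.thetaU (J.neg.thetaU (J.hat α))) := by
  ext d
  rw [SkewCyclic.mem_iff_of_eq_span J.mu_theta hD hC]
  have h2 : J.neg.theta.1 (J.neg.theta.1 (J.mu α)) *
      (J.neg.thetaU (J.neg.thetaU (J.hat α)) : J.neg.K) = 1 := by
    rw [hat_eq_inv hα hJ, coe_thetaU, coe_thetaU, ← map_mul, ← map_mul, ← coe_muU, Units.mul_inv,
      map_one, map_one]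
  have h3 := SkewCyclic.mul_sq_sub_eq_zero_iff (norm_mu hα) h2 d
  rw [codeOne]
  refine Iff.trans ?_ h3
  suffices h : SkewCyclic.star J.neg.theta J.mu (-const (α : J.K) + y : J.R) =
      y ^ 2 - const (J.mu α) by rw [h]
  rw [pow_two]
  apply SkewCyclic.ext3 <;> simp

omit hJ in
theorem Coset.dual_top (hC : C = ⊤) : D = ⊥ := by
  rw [← Ideal.span_singleton_one] at hC
  ext d
  rw [SkewCyclic.mem_iff_of_eq_span J.mu_theta hD hC, SkewCyclic.star_one, mul_one,
    Submodule.mem_bot]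

omit hJ in
theorem Coset.dual_bot (hC : C = ⊥) : D = ⊤ := by
  refine eq_top_iff.2 fun d _ => (hD d).2 fun c hc => ?_
  rw [hC, Submodule.mem_bot] at hc
  rw [hc, SkewCyclic.star_zero, mul_zero]

end NotFixed

end MetacyclicData

theorem theorem4p5 {F L : Type*} [Field F] [Fintype F] [Field L] [Algebra F L]
    (P : MetacyclicData F L)
    -- a primitive element of each `Kᵢ`
    (z : ∀ J : P.Coset, J.Kˣ) (hz : ∀ (J : P.Coset) (u : J.Kˣ), u ∈ Subgroup.zpowers (z J))
    (𝒞 : Set P.GroupAlg) (h𝒞 : IsLeftCode 𝒞)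
    (C : ∀ J : P.Coset, Ideal J.R) (hC : MetacyclicData.IsConcatSum 𝒞 C) :
    IsLeftCode (euclideanDual 𝒞) ∧
    ∃ D : ∀ J : P.Coset, Ideal J.R,
      MetacyclicData.IsConcatSum (euclideanDual 𝒞) D ∧
      ∀ J : P.Coset,
        (J.IsFixed →
          (∀ a, J.theta.1 a = a) ∧
          (P.q % 3 = 0 → J.FollowsTable J.tableZero (C J) (D J.neg)) ∧
          (P.q ^ J.d % 3 = 2 → J.FollowsTable J.tableTwo (C J) (D J.neg)) ∧
          (P.q ^ J.d % 3 = 1 →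
            J.FollowsTable (J.tableOne (J.omega (z J)) (J.mu (J.omega (z J)))) (C J) (D J.neg))) ∧
        (¬ J.IsFixed →
          ((∃ α ∈ J.calG (z J), C J = J.codeOne α) ∨ (∃ α ∈ J.calG (z J), C J = J.codeTwo α) ∨
            C J = ⊤ ∨ C J = ⊥) ∧
          (∀ α ∈ J.calG (z J), C J = J.codeOne α →
            J.neg.thetaU (J.hat α) ∈ J.neg.calG (z J.neg) ∧
            D J.neg = J.neg.codeTwo (J.neg.thetaU (J.hat α)) ∧
            SkewCyclic.IsGeneratorMatrix
              !![-(J.neg.thetaU (J.hat α) : J.neg.K), 1, 0;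
                 0, -(J.neg.thetaU (J.neg.thetaU (J.hat α)) : J.neg.K), 1] (D J.neg)) ∧
          (∀ α ∈ J.calG (z J), C J = J.codeTwo α →
            J.neg.thetaU (J.neg.thetaU (J.hat α)) ∈ J.neg.calG (z J.neg) ∧
            D J.neg = Ideal.span
              {SkewCyclic.const (J.neg.thetaU (J.neg.thetaU (J.hat α)⁻¹) : J.neg.K) +
                SkewCyclic.const (J.neg.thetaU (J.hat α) : J.neg.K) * SkewCyclic.y +
                SkewCyclic.y ^ 2} ∧
            D J.neg = J.neg.codeOne (J.neg.thetaU (J.neg.thetaU (J.hat α))) ∧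
            SkewCyclic.IsGeneratorMatrix
              !![(((J.neg.thetaU (J.neg.thetaU (J.hat α)))⁻¹ : J.neg.Kˣ) : J.neg.K),
                 (J.neg.thetaU (J.neg.thetaU
                   (J.neg.thetaU (J.neg.thetaU (J.hat α)))) : J.neg.K), 1] (D J.neg)) ∧
          (C J = ⊤ → D J.neg = ⊥) ∧
          (C J = ⊥ → D J.neg = ⊤)) := by
  obtain ⟨hcode, D, hDsum, hD⟩ := MetacyclicData.exists_dual 𝒞 h𝒞 C hC
  refine ⟨hcode, D, hDsum, fun J => ⟨fun hJ => ?_, fun hJ => ?_⟩⟩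
  · exact ⟨J.theta_eq_self_iff.2 hJ, MetacyclicData.Coset.followsTable_zero hJ (hD J),
      MetacyclicData.Coset.followsTable_two hJ (hD J),
      MetacyclicData.Coset.followsTable_one hJ (hD J) (hz J)⟩
  have hJ' : ¬ J.neg.IsFixed := fun h => hJ (MetacyclicData.Coset.isFixed_neg.1 h)
  have hG := MetacyclicData.Coset.mem_calG_iff hJ (hz J)
  have hG' := MetacyclicData.Coset.mem_calG_iff hJ' (hz J.neg)
  refine ⟨?_, fun α hα hCα => ?_, fun α hα hCα => ?_,
    MetacyclicData.Coset.dual_top (hD J), MetacyclicData.Coset.dual_bot (hD J)⟩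
  · simp only [hG]
    exact SkewCyclic.ideal_classification J.isField_K (C J)
  · rw [hG] at hα
    have hN := MetacyclicData.Coset.norm_theta (MetacyclicData.Coset.norm_hat hα hJ)
    have hDJ := MetacyclicData.Coset.dual_codeOne hJ (hD J) hα hCα
    refine ⟨(hG' _).2 hN, hDJ, ?_⟩
    rw [hDJ]
    exact SkewCyclic.isGeneratorMatrix_y_sub hN
  · rw [hG] at hα
    have hN := MetacyclicData.Coset.norm_theta
      (MetacyclicData.Coset.norm_theta (MetacyclicData.Coset.norm_hat hα hJ))
    have hDJ := MetacyclicData.Coset.dual_codeTwo hJ (hD J) hα hCα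
    refine ⟨(hG' _).2 hN, ?_, hDJ, ?_⟩
    · rw [hDJ, MetacyclicData.Coset.codeOne, map_inv, map_inv]
      -- Again `θ⁴ = θ`, which identifies the middle coefficient of the generator of `codeOne` with
      -- `θ(α̂)`.
      have h : J.neg.thetaU (J.neg.thetaU (J.neg.thetaU (J.neg.thetaU (J.hat α)))) =
          J.neg.thetaU (J.hat α) := Units.ext (J.neg.theta.2 _)
      rw [h]
    · rw [hDJ]
      have := J.neg.isField_K.nontrivial
      exact SkewCyclic.isGeneratorMatrix_quadratic hN
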